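/- Let $d\ge 2$ and $m\ge 1$ be integers with $(d,m)\neq(2,1)$, let $X=\mathbb{Z}/d\mathbb{Z}=\{0,\dots,d-1\}$, $B=(\mathbb{Z}/d\mathbb{Z})^m$, and let $\mathrm{Epi}(B,A)$ be the set of epimorphisms from $B$ to $A=\langle a\rangle\cong\mathbb{Z}/d\mathbb{Z}$. Let $\omega=(\omega_n)_{n\ge 0}$ be a sequence in $\mathrm{Epi}(B,A)$ with $\bigcap_{j\ge i}\mathrm{Ker}(\omega_j)=1$ for all $i\ge 0$. Let $a^j$ act on $X^{\mathbb{N}}$ by adding $j$ modulo $d$ to the first letter, and let $b\in B$ act on $X^{\mathbb{N}}$ as follows: if $\xi$ has a prefix $(d-1)^r0$ with $r\ge 0$, then the letter following this prefix is increased by $j$ modulo $d$, where $\omega_r(b)=a^j$; otherwise $\xi$ is fixed. Let $G_\omega$ be the group generated by these transformations (a spinal group), with generating set $S=(A\cup B)\setminus\{1\}$. For $\xi\in X^{\mathbb{N}}$ let $\Gamma_\xi$ be the Schreier graph on the orbit $G_\omega\xi$, with an edge labeled $s$ from $\eta$ to $s\eta$ for every vertex $\eta$ and every $s\in S$, and let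 $\mathrm{Cof}(\xi)$ be the set of sequences that differ from $\xi$ in finitely many letters. Let $\mathcal{G}_{*,S}$ be the space of isomorphism classes of connected, locally finite, rooted, directed graphs with edges labeled by $S$, with the topology generated by the cylinder sets (for $r\ge 0$ and a rooted graph, all rooted graphs whose $r$-ball around the root is isomorphic to that of the given one), and let $\mathrm{Sch}:X^{\mathbb{N}}\to\mathcal{G}_{*,S}$, $\mathrm{Sch}(\xi)=(\Gamma_\xi,\xi)$. For $\pi\in\mathrm{Epi}(B,A)$ let $\Lambda_\pi$ be the graph on $X$ with an edge labeled $b$ from $i$ to $i+j$ for every $i\in X$ and every $b\in B\setminus\{1\}$, where $\pi(b)=a^j$; and let $\tilde\Gamma_\pi=\mathrm{Star}(\Lambda_\pi,\Gamma_{(d-1)^{\mathbb{N}}},(d-1)^{\mathbb{N}})$ be the graph obtained from $\Lambda_\pi$ and $d$ disjoint copies, indexed by $X$, of $\Gamma_{(d-1)^{\mathbb{N}}}$ with all loops at the vertex $(d-1)^{\mathbb{N}}$ removed, by identifying, for each $i\in X$, the vertex $(d-1)^{\mathbb{N}}$ of the $i$-th copy with the vertex $i$ of $\Lambda_\pi$.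 Then: 1. The map $\mathrm{Sch}$ is injective. It is continuous at $\xi\in X^{\mathbb{N}}$ if and only if $\xi\notin\mathrm{Cof}((d-1)^{\mathbb{N}})$. 2. If $d>2$, the set $\overline{\mathrm{Sch}(X^{\mathbb{N}})}$ has no isolated points. If $d=2$, its set of isolated points is $\mathrm{Sch}(\mathrm{Cof}(1^{\mathbb{N}}))$. 3. The set $\overline{\mathrm{Sch}(X^{\mathbb{N}})}$ is the disjoint union of $\mathrm{Sch}(X^{\mathbb{N}})$ and a countable set, namely the set of all rooted graphs $(\tilde\Gamma_\pi,v)$, where $\pi$ is one of the finitely many epimorphisms that occur infinitely often in $\omega$ and $v$ is any vertex of $\tilde\Gamma_\pi$. Each of these graphs $\tilde\Gamma_\pi$ has exactly $d$ ends. -/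

import Mathlib

open Set Topology

/-! ### Directed graphs with labelled edges -/

/-- A directed graph on the vertex set `V` with edges labelled by `L`. Loops and parallel edges
with distinct labels are allowed: `edge s u v` says that there is an `s`-edge from `u` to `v`. -/
structure LabeledGraph (L : Type*) (V : Type*) where
  edge : L → V → V → Prop

namespace LabeledGraph

variable {L V W X : Type*}

/-- The underlying simple graph: orientations, labels, loops and multiplicities are forgotten. -/
def toSimpleGraph (Γ : LabeledGraph L V) : SimpleGraph V :=
  SimpleGraph.fromRel fun u v => ∃ s, Γ.edge s u v

/-- Every vertex has only finitely many incident edges. -/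
def IsLocallyFinite (Γ : LabeledGraph L V) : Prop :=
  ∀ u, {p : L × V | Γ.edge p.1 u p.2 ∨ Γ.edge p.1 p.2 u}.Finite

/-- The induced subgraph on a set of vertices. -/
def induce (Γ : LabeledGraph L V) (A : Set V) : LabeledGraph L A where
  edge s u v := Γ.edge s u v

/-- `(Γ, u)` and `(Δ, v)` are isomorphic as rooted, directed, labelled graphs. -/
def RootedIso (Γ : LabeledGraph L V) (u : V) (Δ : LabeledGraph L W) (v : W) : Prop :=
  ∃ e : V ≃ W, e u = v ∧ ∀ s x y, Γ.edge s x y ↔ Δ.edge s (e x) (e y)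

/-- The vertices of the ball of radius `r` around `u` for the (undirected) path metric. -/
def ballSet (Γ : LabeledGraph L V) (u : V) (r : ℕ) : Set V :=
  {v | ∃ p : Γ.toSimpleGraph.Walk u v, p.length ≤ r}

theorem mem_ballSet_self (Γ : LabeledGraph L V) (u : V) (r : ℕ) : u ∈ Γ.ballSet u r :=
  ⟨SimpleGraph.Walk.nil, Nat.zero_le r⟩

/-- The balls of radius `r` around the roots are isomorphic as rooted labelled graphs. -/
def BallIso (r : ℕ) (Γ : LabeledGraph L V) (u : V) (Δ : LabeledGraph L W) (v : W) : Prop :=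
  RootedIso (Γ.induce (Γ.ballSet u r)) ⟨u, Γ.mem_ballSet_self u r⟩
    (Δ.induce (Δ.ballSet v r)) ⟨v, Δ.mem_ballSet_self v r⟩

/-- `Star(Λ, Γ, v)`, where `X` is the vertex set of `Λ`: take one copy of `Γ` for every `i : X`,
remove from each copy the loops at the vertex corresponding to `v`, and identify that vertex of
the `i`-th copy with the vertex `i` of `Λ`. The vertex `(u, i)` is the vertex `u` of the `i`-th
copy; the vertex `i` of `Λ` is thus `(v, i)`. -/
def star (Λ : LabeledGraph L X) (Γ : LabeledGraph L V) (v : V) : LabeledGraph L (V × X) where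
  edge s p q :=
    (p.2 = q.2 ∧ Γ.edge s p.1 q.1 ∧ ¬(p.1 = v ∧ q.1 = v)) ∨
      (p.1 = v ∧ q.1 = v ∧ Λ.edge s p.2 q.2)

theorem adj_of_edge (Γ : LabeledGraph L V) {s : L} {u v : V} (h : Γ.edge s u v) (hne : u ≠ v) :
    Γ.toSimpleGraph.Adj u v := by
  simp only [toSimpleGraph, SimpleGraph.fromRel_adj]
  exact ⟨hne, Or.inl ⟨s, h⟩⟩

theorem reachable_of_edge (Γ : LabeledGraph L V) {s : L} {u v : V} (h : Γ.edge s u v) :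
    Γ.toSimpleGraph.Reachable u v := by
  by_cases hne : u = v
  · rw [hne]
  · exact (Γ.adj_of_edge h hne).reachable

theorem star_connected (Λ : LabeledGraph L X) (Γ : LabeledGraph L V) (v : V)
    (hΛ : Λ.toSimpleGraph.Connected) (hΓ : Γ.toSimpleGraph.Connected) :
    (star Λ Γ v).toSimpleGraph.Connected := by
  have h1 : ∀ (i : X) (u w : V), (star Λ Γ v).toSimpleGraph.Reachable (u, i) (w, i) := by
    intro i u w
    let f : Γ.toSimpleGraph →g (star Λ Γ v).toSimpleGraph :=
      { toFun := fun x => (x, i)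
        map_rel' := by
          intro x y hxy
          simp only [toSimpleGraph, SimpleGraph.fromRel_adj] at hxy ⊢
          obtain ⟨hne, h⟩ := hxy
          refine ⟨fun h => hne (congrArg Prod.fst h), ?_⟩
          rcases h with ⟨s, h⟩ | ⟨s, h⟩
          · exact Or.inl ⟨s, Or.inl ⟨rfl, h, fun hh => hne (hh.1.trans hh.2.symm)⟩⟩
          · exact Or.inr ⟨s, Or.inl ⟨rfl, h, fun hh => hne (hh.2.trans hh.1.symm)⟩⟩ }
    exact (hΓ.preconnected u w).map f
  have h2 : ∀ i j : X, (star Λ Γ v).toSimpleGraph.Reachable (v, i) (v, j) := by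
    intro i j
    let f : Λ.toSimpleGraph →g (star Λ Γ v).toSimpleGraph :=
      { toFun := fun x => (v, x)
        map_rel' := by
          intro x y hxy
          simp only [toSimpleGraph, SimpleGraph.fromRel_adj] at hxy ⊢
          obtain ⟨hne, h⟩ := hxy
          refine ⟨fun h => hne (congrArg Prod.snd h), ?_⟩
          rcases h with ⟨s, h⟩ | ⟨s, h⟩
          · exact Or.inl ⟨s, Or.inr ⟨rfl, rfl, h⟩⟩
          · exact Or.inr ⟨s, Or.inr ⟨rfl, rfl, h⟩⟩ }
    exact (hΛ.preconnected i j).map f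
  obtain ⟨i⟩ := hΛ.nonempty
  have : Nonempty (V × X) := ⟨(v, i)⟩
  refine SimpleGraph.Connected.mk ?_
  rintro ⟨u, i⟩ ⟨w, j⟩
  exact ((h1 i u v).trans (h2 i j)).trans (h1 j v w)

theorem star_locallyFinite (Λ : LabeledGraph L X) (Γ : LabeledGraph L V) (v : V)
    (hΛ : Λ.IsLocallyFinite) (hΓ : Γ.IsLocallyFinite) : (star Λ Γ v).IsLocallyFinite := by
  rintro ⟨u, i⟩
  refine (((hΓ u).image fun p => (p.1, (p.2, i))).union
    ((hΛ i).image fun p => (p.1, (v, p.2)))).subset ?_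
  rintro ⟨s, w, j⟩ h
  simp only [star, mem_ofPred_eq] at h
  rcases h with (⟨h1, h2, -⟩ | ⟨-, h2, h3⟩) | (⟨h1, h2, -⟩ | ⟨h2, -, h3⟩)
  · exact Or.inl ⟨(s, w), Or.inl h2, by simp [h1]⟩
  · exact Or.inr ⟨(s, j), Or.inl h3, by simp [h2]⟩
  · exact Or.inl ⟨(s, w), Or.inr h2, by simp [h1]⟩
  · exact Or.inr ⟨(s, j), Or.inr h3, by simp [h2]⟩

/-- The orbital Schreier graph of a group `G` with a family of generators `gen` on the orbit of
`y`: from every vertex `u` and for every label `s` there is an `s`-edge to `gen s • u`. -/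
def orbitalSchreier {G Y : Type*} [Group G] [MulAction G Y] (gen : L → G) (y : Y) :
    LabeledGraph L (MulAction.orbit G y) where
  edge s u v := v = gen s • u

theorem orbitalSchreier_locallyFinite {G Y : Type*} [Group G] [MulAction G Y] [Finite L]
    (gen : L → G) (y : Y) : (orbitalSchreier gen y).IsLocallyFinite := by
  intro u
  refine ((Set.finite_range fun s : L => (s, gen s • u)).union
    (Set.finite_range fun s : L => (s, (gen s)⁻¹ • u))).subset ?_
  rintro ⟨s, w⟩ (h | h)
  · exact Or.inl ⟨s, by simp only [orbitalSchreier] at h; rw [h]⟩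
  · exact Or.inr ⟨s, by simp only [orbitalSchreier] at h; simp [h]⟩

theorem orbitalSchreier_connected {G Y : Type*} [Group G] [MulAction G Y]
    (gen : L → G) (hgen : Subgroup.closure (range gen) = ⊤) (y : Y) :
    (orbitalSchreier gen y).toSimpleGraph.Connected := by
  have key : ∀ (g : G) (u : MulAction.orbit G y),
      (orbitalSchreier gen y).toSimpleGraph.Reachable u (g • u) := by
    intro g
    have hg : g ∈ Subgroup.closure (range gen) := by rw [hgen]; trivial
    induction hg using Subgroup.closure_induction with
    | mem x hx =>
      obtain ⟨s, rfl⟩ := hx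
      intro u
      exact reachable_of_edge _ (s := s) rfl
    | one => intro u; rw [one_smul]
    | mul x z _ _ h1 h2 => intro u; rw [mul_smul]; exact (h2 u).trans (h1 _)
    | inv x _ h =>
      intro u
      have := h (x⁻¹ • u)
      rw [smul_inv_smul] at this
      exact this.symm
  have : Nonempty (MulAction.orbit G y) := ⟨⟨y, MulAction.mem_orbit_self y⟩⟩
  refine SimpleGraph.Connected.mk ?_
  intro u v
  obtain ⟨g, hg⟩ := MulAction.exists_smul_eq G u v
  exact hg ▸ key g u

end LabeledGraph

/-! ### The space of rooted labelled graphs -/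

/-- Connected, locally finite, directed graphs with labels in `L` and a root. -/
structure RootedGraph (L : Type) where
  V : Type
  graph : LabeledGraph L V
  root : V
  connected : graph.toSimpleGraph.Connected
  locallyFinite : graph.IsLocallyFinite

instance RootedGraph.isoSetoid (L : Type) : Setoid (RootedGraph L) where
  r Γ Δ := Γ.graph.RootedIso Γ.root Δ.graph Δ.root
  iseqv :=
    { refl := fun _ => ⟨Equiv.refl _, rfl, fun _ _ _ => Iff.rfl⟩
      symm := by
        rintro Γ Δ ⟨e, he, h⟩
        exact ⟨e.symm, by rw [← he, e.symm_apply_apply], fun s x y => by rw [h]; simp⟩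
      trans := by
        rintro Γ Δ Θ ⟨e, he, h⟩ ⟨f, hf, h'⟩
        exact ⟨e.trans f, by simp [he, hf], fun s x y => (h s x y).trans (h' s _ _)⟩ }

/-- The space of rooted, directed, labelled graphs up to rooted labelled isomorphism. -/
def RootedGraphSpace (L : Type) : Type 1 := Quotient (RootedGraph.isoSetoid L)

/-- The class of a rooted graph in the space of rooted graphs. -/
def RootedGraph.toSpace {L : Type} (Γ : RootedGraph L) : RootedGraphSpace L := Quotient.mk _ Γ

/-- The cylinder set of all rooted graphs whose `r`-ball around the root is isomorphic to that
of `Γ`. -/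
def RootedGraph.cylinder {L : Type} (Γ : RootedGraph L) (r : ℕ) : Set (RootedGraphSpace L) :=
  {x | ∃ Δ : RootedGraph L, x = Δ.toSpace ∧ Γ.graph.BallIso r Γ.root Δ.graph Δ.root}

/-- The pointed Gromov-Hausdorff topology, generated by the cylinder sets. -/
instance RootedGraphSpace.instTopologicalSpace (L : Type) :
    TopologicalSpace (RootedGraphSpace L) :=
  TopologicalSpace.generateFrom {U | ∃ (Γ : RootedGraph L) (r : ℕ), U = Γ.cylinder r}

/-- The isolated points of a subset `C` of a topological space, for the induced topology. -/
def isolatedPoints {Y : Type*} [TopologicalSpace Y] (C : Set Y) : Set Y :=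
  {x | ∃ U : Set Y, IsOpen U ∧ U ∩ C = {x}}

/-! ### Spinal groups -/

namespace Spinal

/-- The boundary `X^ℕ` of the `d`-regular rooted tree, with alphabet `X = ℤ/dℤ`, whose letter
`d - 1` is `-1`; it carries the product of the discrete topologies. -/
abbrev Boundary (d : ℕ) : Type := ℕ → ZMod d

/-- The cofinality class of `ξ`. -/
def Cof {d : ℕ} (ξ : Boundary d) : Set (Boundary d) := {η | ∃ r, ∀ n, r ≤ n → ξ n = η n}

/-- The constant sequence `(d - 1)^ℕ`. -/
def lastRay (d : ℕ) : Boundary d := fun _ => -1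

/-- The group `B = (ℤ/dℤ)^m`. -/
abbrev B (d m : ℕ) : Type := Fin m → ZMod d

/-- Epimorphisms from `B` to `A = ⟨a⟩ ≅ ℤ/dℤ`, where `a ^ j` corresponds to `j`. -/
def Epi (d m : ℕ) : Type := {f : B d m →+ ZMod d // Function.Surjective f}

/-- The sequences of epimorphisms such that `⋂_{j ≥ i} Ker (ω_j)` is trivial for every `i`. -/
def Omega (d m : ℕ) : Set (ℕ → Epi d m) :=
  {ω | ∀ i, ⨅ j ≥ i, (ω j).1.ker = ⊥}

/-- The rotation `a ^ j`, adding `j` to the first letter. -/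
def rotFun {d : ℕ} (j : ZMod d) (ξ : Boundary d) : Boundary d
  | 0 => ξ 0 + j
  | n + 1 => ξ (n + 1)

/-- The rotation `a ^ j` as a permutation of the boundary. -/
def rot {d : ℕ} (j : ZMod d) : Equiv.Perm (Boundary d) where
  toFun := rotFun j
  invFun := rotFun (-j)
  left_inv ξ := by funext n; cases n <;> simp [rotFun]
  right_inv ξ := by funext n; cases n <;> simp [rotFun]

open Classical in
/-- For every `n`, the letter following a prefix `(d-1)^n 0` is increased by `f n`; all other
letters are kept. -/
noncomputable def spineFun {d : ℕ} (f : ℕ → ZMod d) (ξ : Boundary d) : Boundary d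
  | 0 => ξ 0
  | n + 1 => if (∀ k < n, ξ k = -1) ∧ ξ n = 0 then ξ (n + 1) + f n else ξ (n + 1)

theorem spineFun_inv {d : ℕ} (f g : ℕ → ZMod d) (hfg : ∀ n, f n + g n = 0) (ξ : Boundary d) :
    spineFun g (spineFun f ξ) = ξ := by
  by_cases hd : d = 1
  · subst hd
    funext n
    exact Subsingleton.elim _ _
  have hne : (-1 : ZMod d) ≠ 0 := by
    have : Nontrivial (ZMod d) := ZMod.nontrivial_iff.mpr hd
    exact neg_ne_zero.mpr one_ne_zero
  have hpre : ∀ n, (∀ k < n, ξ k = -1) → ∀ k ≤ n, spineFun f ξ k = ξ k := by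
    intro n hn k hk
    cases k with
    | zero => rfl
    | succ k =>
      have : ¬((∀ l < k, ξ l = -1) ∧ ξ k = 0) := by
        rintro ⟨-, h0⟩
        exact hne ((hn k (by omega)).symm.trans h0)
      simp only [spineFun, if_neg this]
  have hpre' : ∀ n, (∀ k < n, spineFun f ξ k = -1) → ∀ k < n, ξ k = -1 := by
    intro n
    induction n with
    | zero => intro _ k hk; omega
    | succ n ih =>
      intro h k hk
      have h1 := ih fun k hk => h k (by omega)
      rw [← hpre n h1 k (by omega)]
      exact h k hk
  have hcond : ∀ n, ((∀ k < n, spineFun f ξ k = -1) ∧ spineFun f ξ n = 0) ↔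
      ((∀ k < n, ξ k = -1) ∧ ξ n = 0) := by
    intro n
    constructor
    · rintro ⟨h1, h2⟩
      have h3 := hpre' n h1
      exact ⟨h3, by rw [← hpre n h3 n le_rfl]; exact h2⟩
    · rintro ⟨h1, h2⟩
      exact ⟨fun k hk => by rw [hpre n h1 k hk.le]; exact h1 k hk,
        by rw [hpre n h1 n le_rfl]; exact h2⟩
  funext n
  cases n with
  | zero => rfl
  | succ n =>
    by_cases h : (∀ k < n, ξ k = -1) ∧ ξ n = 0
    · have h' := (hcond n).mpr h
      calc spineFun g (spineFun f ξ) (n + 1) = spineFun f ξ (n + 1) + g n := if_pos h'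
        _ = ξ (n + 1) + f n + g n := by rw [show spineFun f ξ (n + 1) = _ from if_pos h]
        _ = ξ (n + 1) := by rw [add_assoc, hfg, add_zero]
    · have h' := fun hh => h ((hcond n).mp hh)
      calc spineFun g (spineFun f ξ) (n + 1) = spineFun f ξ (n + 1) := if_neg h'
        _ = ξ (n + 1) := if_neg h

/-- The spinal automorphism `b_ω`, through its action on the boundary of the tree: it fixes `ξ`
unless `ξ` has a prefix `(d-1)^r 0`, in which case it applies `ω_r(b)` to the next letter. -/
noncomputable def spine {d m : ℕ} (ω : ℕ → Epi d m) (b : B d m) : Equiv.Perm (Boundary d) where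
  toFun := spineFun fun n => (ω n).1 b
  invFun := spineFun fun n => -(ω n).1 b
  left_inv := spineFun_inv _ _ fun _ => add_neg_cancel _
  right_inv := spineFun_inv _ _ fun _ => neg_add_cancel _

/-- The nontrivial elements of `A` and of `B`, which label the edges of Schreier graphs. -/
abbrev Label (d m : ℕ) : Type := {j : ZMod d // j ≠ 0} ⊕ {b : B d m // b ≠ 0}

/-- The permutation of the boundary given by a label. -/
noncomputable def labelPerm {d m : ℕ} (ω : ℕ → Epi d m) : Label d m → Equiv.Perm (Boundary d)
  | Sum.inl j => rot j.1
  | Sum.inr b => spine ω b.1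

/-- The labels are in bijection with the spinal generating set `(A ∪ B_ω) \ {1}`. -/
theorem labelPerm_bijOn {d m : ℕ} {ω : ℕ → Epi d m} (hω : ω ∈ Omega d m) :
    BijOn (labelPerm ω) univ ((range rot ∪ range (spine ω)) \ {1}) := by
  have hrot : ∀ j : ZMod d, rot j = 1 → j = 0 := by
    intro j h
    have := congrFun (congrArg (fun e : Equiv.Perm (Boundary d) => e fun _ => 0) h) 0
    simpa [rot, rotFun] using this
  have hspine : ∀ b b' : B d m, spine ω b = spine ω b' → b = b' := by
    intro b b' h
    have hall : ∀ n, (ω n).1 b = (ω n).1 b' := by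
      intro n
      have h1 := congrFun (congrArg (fun e : Equiv.Perm (Boundary d) =>
        e fun k => if k < n then -1 else 0) h) (n + 1)
      have hc : (∀ k < n, (if k < n then (-1 : ZMod d) else 0) = -1) ∧
          (if n < n then (-1 : ZMod d) else 0) = 0 :=
        ⟨fun k hk => if_pos hk, if_neg (lt_irrefl n)⟩
      simp only [spine, Equiv.coe_fn_mk, spineFun] at h1
      rw [if_pos hc, if_pos hc] at h1
      exact add_left_cancel h1
    have hmem : b - b' ∈ ⨅ j ≥ 0, (ω j).1.ker := by
      simp only [AddSubgroup.mem_iInf, AddMonoidHom.mem_ker, map_sub]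
      exact fun j _ => sub_eq_zero.mpr (hall j)
    rw [hω 0, AddSubgroup.mem_bot] at hmem
    exact sub_eq_zero.mp hmem
  have hzero : spine ω 0 = 1 := by
    ext ξ n
    cases n with
    | zero => rfl
    | succ n => simp [spine, spineFun]
  have hmix : ∀ (j : ZMod d) (b : B d m), rot j = spine ω b → j = 0 := by
    intro j b h
    have := congrFun (congrArg (fun e : Equiv.Perm (Boundary d) => e fun _ => 0) h) 0
    simpa [rot, rotFun, spine, spineFun] using this
  have hrot_inj : ∀ j j' : ZMod d, rot j = rot j' → j = j' := by
    intro j j' h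
    have := congrFun (congrArg (fun e : Equiv.Perm (Boundary d) => e fun _ => 0) h) 0
    simpa [rot, rotFun] using this
  refine ⟨?_, ?_, ?_⟩
  · rintro (j | b) -
    · exact ⟨Or.inl ⟨j.1, rfl⟩, fun h => j.2 (hrot _ h)⟩
    · exact ⟨Or.inr ⟨b.1, rfl⟩, fun h => b.2 (hspine _ _ (Eq.trans h hzero.symm))⟩
  · rintro (j | b) - (j' | b') - h
    · exact congrArg Sum.inl (Subtype.ext (hrot_inj _ _ h))
    · exact absurd (hmix _ _ h) j.2
    · exact absurd (hmix _ _ h.symm) j'.2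
    · exact congrArg Sum.inr (Subtype.ext (hspine _ _ h))
  · rintro _ ⟨⟨j, rfl⟩ | ⟨b, rfl⟩, h⟩
    · refine ⟨Sum.inl ⟨j, fun h0 => h ?_⟩, trivial, rfl⟩
      subst h0
      show rot 0 = 1
      ext ξ n
      cases n <;> simp [rot, rotFun]
    · refine ⟨Sum.inr ⟨b, fun h0 => h ?_⟩, trivial, rfl⟩
      subst h0
      exact hzero

/-- The spinal group `G_ω = ⟨A, B_ω⟩`, as a group of permutations of the boundary (on which
tree automorphisms act faithfully). -/
def spinalGroup {d m : ℕ} (ω : ℕ → Epi d m) : Subgroup (Equiv.Perm (Boundary d)) :=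
  Subgroup.closure (range (labelPerm ω))

/-- The generator of `G_ω` given by a label. -/
noncomputable def gen {d m : ℕ} (ω : ℕ → Epi d m) (s : Label d m) : spinalGroup ω :=
  ⟨labelPerm ω s, Subgroup.subset_closure ⟨s, rfl⟩⟩

theorem closure_gen {d m : ℕ} (ω : ℕ → Epi d m) : Subgroup.closure (range (gen ω)) = ⊤ := by
  have h : range (gen ω) =
      ((↑) : Subgroup.closure (range (labelPerm ω)) → _) ⁻¹' range (labelPerm ω) := by
    ext x
    constructor
    · rintro ⟨s, rfl⟩
      exact ⟨s, rfl⟩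
    · rintro ⟨s, hs⟩
      exact ⟨s, Subtype.ext hs⟩
  rw [h]
  exact Subgroup.closure_closure_coe_preimage

/-- The Schreier graph `Γ_ξ` of `G_ω` on the orbit of `ξ`. -/
noncomputable def schreierGraph {d m : ℕ} (ω : ℕ → Epi d m) (ξ : Boundary d) :
    LabeledGraph (Label d m) (MulAction.orbit (spinalGroup ω) ξ) :=
  LabeledGraph.orbitalSchreier (gen ω) ξ

/-- The rooted Schreier graph `(Γ_ξ, ξ)`. -/
noncomputable def rootedSchreier {d m : ℕ} [NeZero d] (ω : ℕ → Epi d m) (ξ : Boundary d) :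
    RootedGraph (Label d m) where
  V := MulAction.orbit (spinalGroup ω) ξ
  graph := schreierGraph ω ξ
  root := ⟨ξ, MulAction.mem_orbit_self ξ⟩
  connected := LabeledGraph.orbitalSchreier_connected _ (closure_gen ω) ξ
  locallyFinite := LabeledGraph.orbitalSchreier_locallyFinite _ ξ

/-- The map `Sch` from the boundary to the space of rooted labelled graphs. -/
noncomputable def Sch {d m : ℕ} [NeZero d] (ω : ℕ → Epi d m) (ξ : Boundary d) :
    RootedGraphSpace (Label d m) :=
  (rootedSchreier ω ξ).toSpace

/-- The graph `Λ_π` on `X`: for every nontrivial `b` in `B` and every `i` there is a `b`-edge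
from `i` to `i + π(b)`. -/
def lambdaGraph {d m : ℕ} (π : Epi d m) : LabeledGraph (Label d m) (ZMod d) where
  edge s i j :=
    match s with
    | Sum.inl _ => False
    | Sum.inr b => j = i + π.1 b.1

theorem lambdaGraph_connected {d m : ℕ} (π : Epi d m) :
    (lambdaGraph π).toSimpleGraph.Connected := by
  refine SimpleGraph.Connected.mk ?_
  intro i j
  by_cases hij : i = j
  · rw [hij]
  obtain ⟨b, hb⟩ := π.2 (j - i)
  have hb0 : b ≠ 0 := by
    rintro rfl
    rw [map_zero] at hb
    exact hij (sub_eq_zero.mp hb.symm).symm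
  refine LabeledGraph.reachable_of_edge _ (s := Sum.inr ⟨b, hb0⟩) ?_
  show j = i + π.1 b
  rw [hb]
  abel

/-- The graph `Star(Λ_π, Γ_{(d-1)^ℕ}, (d-1)^ℕ)`. -/
noncomputable def tildeGamma {d m : ℕ} (ω : ℕ → Epi d m) (π : Epi d m) :
    LabeledGraph (Label d m) (MulAction.orbit (spinalGroup ω) (lastRay d) × ZMod d) :=
  LabeledGraph.star (lambdaGraph π) (schreierGraph ω (lastRay d))
    ⟨lastRay d, MulAction.mem_orbit_self (lastRay d)⟩

/-- The graph `Star(Λ_π, Γ_{(d-1)^ℕ}, (d-1)^ℕ)` rooted at the vertex `v`. -/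
noncomputable def rootedTildeGamma {d m : ℕ} [NeZero d] (ω : ℕ → Epi d m) (π : Epi d m)
    (v : MulAction.orbit (spinalGroup ω) (lastRay d) × ZMod d) : RootedGraph (Label d m) where
  V := MulAction.orbit (spinalGroup ω) (lastRay d) × ZMod d
  graph := tildeGamma ω π
  root := v
  connected := LabeledGraph.star_connected _ _ _ (lambdaGraph_connected π)
    (LabeledGraph.orbitalSchreier_connected _ (closure_gen ω) _)
  locallyFinite := LabeledGraph.star_locallyFinite _ _ _ (fun _ => Set.toFinite _)
    (LabeledGraph.orbitalSchreier_locallyFinite _ _)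

/-- The epimorphisms occurring infinitely often in `ω`. -/
def recurrentEpi {d m : ℕ} (ω : ℕ → Epi d m) : Set (Epi d m) := {π | {n | ω n = π}.Infinite}

/-- All rooted versions of the graphs `Star(Λ_π, Γ_{(d-1)^ℕ}, (d-1)^ℕ)`, for the epimorphisms
`π` occurring infinitely often in `ω`. -/
def limitGraphs {d m : ℕ} [NeZero d] (ω : ℕ → Epi d m) : Set (RootedGraphSpace (Label d m)) :=
  {x | ∃ π ∈ recurrentEpi ω, ∃ v, x = (rootedTildeGamma ω π v).toSpace}

end Spinal

/-! The Schreier graphs and the graphs `tildeGamma ω π` are graphs of actions: each label acts as a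
bijection whose inverse is again given by a label. Such a connected rooted graph is determined by
the set of words fixing its root, and its `r`-ball by those of length at most `2 * r + 1`.
Isomorphism, convergence and separation thus become comparisons of stabilisers. Both families sit in
one model, `extAct ω π` on `d` copies of the boundary, where `b` shifts the copy by `π b` at the
point `(d-1)^ℕ` only: `π = 0` gives Schreier graphs, an epimorphism gives `tildeGamma`.

Stabilisers determine the boundary point (`SameStab.apply_eq`): they determine the first letter, and
self-similarity passes this on to the later letters. Hence `Sch` is injective. A limit graph with
the same boundary point is told apart from a Schreier graph by some `b` that shifts the copy at
`(d-1)^ℕ`.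

For convergence, a fixed word sees only a bounded prefix of a point unless it leads to `(d-1)^ℕ`. So
`Sch` is continuous away from the cofinality class of that point. Near a point `ξ` of the class, the
first letter of `ξ'` differing from `ξ`, at position `N`, decides. If it is neither `0` nor `d-1`,
then `B` acts trivially beyond the prefix, and the graphs resemble that of `ξ`. If it is `0`, then
`B` acts on the next letter through `ω N`, and the graphs resemble `tildeGamma ω (ω N)`. There are
finitely many epimorphisms, so compactness of the boundary and an ultrafilter give the closure
(`closure_range_Sch`). For `d = 2` only the letter `0` can occur, which explains the isolated
points.

For the ends, the complements of suitable finite vertex sets have exactly one component in each copy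
(`card_end_tildeGamma`), because cofinal points can be joined by paths that keep a far letter
different from `d-1`. -/

namespace LabeledGraph

variable {L V W X : Type*}

/-! ### Isomorphisms of rooted graphs and of balls -/

theorem RootedIso.refl (Γ : LabeledGraph L V) (u : V) : Γ.RootedIso u Γ u :=
  ⟨Equiv.refl _, rfl, fun _ _ _ => Iff.rfl⟩

theorem RootedIso.symm {Γ : LabeledGraph L V} {u : V} {Δ : LabeledGraph L W} {v : W}
    (h : Γ.RootedIso u Δ v) : Δ.RootedIso v Γ u := by
  obtain ⟨e, he, h⟩ := h
  exact ⟨e.symm, by rw [← he, e.symm_apply_apply], fun s x y => by rw [h]; simp⟩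

theorem RootedIso.trans {Γ : LabeledGraph L V} {u : V} {Δ : LabeledGraph L W} {v : W}
    {Θ : LabeledGraph L X} {x : X} (h : Γ.RootedIso u Δ v) (h' : Δ.RootedIso v Θ x) :
    Γ.RootedIso u Θ x := by
  obtain ⟨e, he, h⟩ := h
  obtain ⟨f, hf, h'⟩ := h'
  exact ⟨e.trans f, by simp [he, hf], fun s x y => (h s x y).trans (h' s _ _)⟩

theorem BallIso.refl (r : ℕ) (Γ : LabeledGraph L V) (u : V) : BallIso r Γ u Γ u :=
  RootedIso.refl _ _

theorem BallIso.symm {r : ℕ} {Γ : LabeledGraph L V} {u : V} {Δ : LabeledGraph L W} {v : W}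
    (h : BallIso r Γ u Δ v) : BallIso r Δ v Γ u :=
  RootedIso.symm h

theorem BallIso.trans {r : ℕ} {Γ : LabeledGraph L V} {u : V} {Δ : LabeledGraph L W} {v : W}
    {Θ : LabeledGraph L X} {x : X} (h : BallIso r Γ u Δ v) (h' : BallIso r Δ v Θ x) :
    BallIso r Γ u Θ x :=
  RootedIso.trans h h'

theorem adj_iff (Γ : LabeledGraph L V) (u v : V) :
    Γ.toSimpleGraph.Adj u v ↔ u ≠ v ∧ ((∃ s, Γ.edge s u v) ∨ ∃ s, Γ.edge s v u) := by
  simp only [toSimpleGraph, SimpleGraph.fromRel_adj]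

theorem mem_ballSet_zero {Γ : LabeledGraph L V} {u v : V} : v ∈ Γ.ballSet u 0 ↔ v = u := by
  constructor
  · rintro ⟨p, hp⟩
    exact (SimpleGraph.Walk.eq_of_length_eq_zero (Nat.le_zero.mp hp)).symm
  · rintro rfl
    exact mem_ballSet_self _ _ _

theorem ballSet_mono (Γ : LabeledGraph L V) (u : V) {r r' : ℕ} (h : r ≤ r') :
    Γ.ballSet u r ⊆ Γ.ballSet u r' :=
  fun _ ⟨p, hp⟩ => ⟨p, hp.trans h⟩

theorem mem_ballSet_of_adj {Γ : LabeledGraph L V} {u v w : V} {r : ℕ} (hv : v ∈ Γ.ballSet u r)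
    (h : Γ.toSimpleGraph.Adj v w) : w ∈ Γ.ballSet u (r + 1) := by
  obtain ⟨p, hp⟩ := hv
  exact ⟨p.concat h, by rw [SimpleGraph.Walk.length_concat]; omega⟩

theorem exists_adj_of_mem_ballSet_succ {Γ : LabeledGraph L V} {u w : V} {r : ℕ}
    (hw : w ∈ Γ.ballSet u (r + 1)) :
    w ∈ Γ.ballSet u r ∨ ∃ v ∈ Γ.ballSet u r, Γ.toSimpleGraph.Adj v w := by
  obtain ⟨p, hp⟩ := hw
  by_cases h : p.length ≤ r
  · exact Or.inl ⟨p, h⟩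
  right
  cases hq : p.reverse with
  | nil =>
    have := congrArg SimpleGraph.Walk.length hq
    simp only [SimpleGraph.Walk.length_reverse, SimpleGraph.Walk.length_nil] at this
    omega
  | cons hadj q =>
    have := congrArg SimpleGraph.Walk.length hq
    simp only [SimpleGraph.Walk.length_reverse, SimpleGraph.Walk.length_cons] at this
    exact ⟨_, ⟨q.reverse, by rw [SimpleGraph.Walk.length_reverse]; omega⟩, hadj.symm⟩

theorem mem_ballSet_of_edge {Γ : LabeledGraph L V} {u v w : V} {r : ℕ} {s : L}
    (hv : v ∈ Γ.ballSet u r) (h : Γ.edge s v w ∨ Γ.edge s w v) : w ∈ Γ.ballSet u (r + 1) := by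
  by_cases hne : v = w
  · subst hne
    exact ballSet_mono _ _ (Nat.le_succ r) hv
  · exact mem_ballSet_of_adj hv ((adj_iff _ _ _).mpr ⟨hne, h.imp (⟨s, ·⟩) (⟨s, ·⟩)⟩)

/-- A shortest walk from the root stays inside the ball, so an isomorphism of `r`-balls does not
increase distances to the root. This allows restriction to smaller balls. -/
theorem mem_ballSet_of_ballIso {r : ℕ} {Γ : LabeledGraph L V} {u : V} {Δ : LabeledGraph L W}
    {v : W} {e : Γ.ballSet u r ≃ Δ.ballSet v r}
    (he : e ⟨u, Γ.mem_ballSet_self u r⟩ = ⟨v, Δ.mem_ballSet_self v r⟩)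
    (h : ∀ s x y, (Γ.induce _).edge s x y ↔ (Δ.induce _).edge s (e x) (e y)) {k : ℕ} (hk : k ≤ r)
    {x : Γ.ballSet u r} (hx : x.1 ∈ Γ.ballSet u k) : (e x).1 ∈ Δ.ballSet v k := by
  induction k generalizing x with
  | zero =>
    rw [mem_ballSet_zero] at hx ⊢
    have : x = ⟨u, Γ.mem_ballSet_self u r⟩ := Subtype.ext hx
    rw [this, he]
  | succ k ih =>
    rcases exists_adj_of_mem_ballSet_succ hx with hx | ⟨y, hy, hadj⟩
    · exact ballSet_mono _ _ (Nat.le_succ k) (ih (by omega) hx)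
    · have hy' : y ∈ Γ.ballSet u r := ballSet_mono _ _ (by omega) hy
      have h1 := ih (x := ⟨y, hy'⟩) (by omega) hy
      rcases (adj_iff _ _ _).mp hadj with ⟨-, ⟨s, hs⟩ | ⟨s, hs⟩⟩
      · exact mem_ballSet_of_edge h1 (Or.inl ((h s ⟨y, hy'⟩ x).mp hs))
      · exact mem_ballSet_of_edge h1 (Or.inr ((h s x ⟨y, hy'⟩).mp hs))

theorem BallIso.mono {r r' : ℕ} (hr : r' ≤ r) {Γ : LabeledGraph L V} {u : V}
    {Δ : LabeledGraph L W} {v : W} (h : BallIso r Γ u Δ v) : BallIso r' Γ u Δ v := by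
  obtain ⟨e, he, h⟩ := h
  have he' : e.symm ⟨v, Δ.mem_ballSet_self v r⟩ = ⟨u, Γ.mem_ballSet_self u r⟩ := by
    rw [← he, e.symm_apply_apply]
  have h' : ∀ s x y, (Δ.induce _).edge s x y ↔ (Γ.induce _).edge s (e.symm x) (e.symm y) :=
    fun s x y => by rw [h]; simp
  have key := fun x hx => mem_ballSet_of_ballIso he h hr (x := x) hx
  have key' := fun x hx => mem_ballSet_of_ballIso he' h' hr (x := x) hx
  refine ⟨{ toFun := fun x => ⟨e ⟨x, ballSet_mono _ _ hr x.2⟩, key _ x.2⟩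
            invFun := fun x => ⟨e.symm ⟨x, ballSet_mono _ _ hr x.2⟩, key' _ x.2⟩
            left_inv := fun x => by simp
            right_inv := fun x => by simp }, ?_, ?_⟩
  · simp [he]
  · intro s x y
    exact h s ⟨x.1, ballSet_mono _ _ hr x.2⟩ ⟨y.1, ballSet_mono _ _ hr y.2⟩

theorem RootedIso.induce_univ (Γ : LabeledGraph L V) (u : V) {A : Set V} (hA : ∀ x, x ∈ A) :
    RootedIso (Γ.induce A) ⟨u, hA u⟩ Γ u :=
  ⟨Equiv.subtypeUnivEquiv hA, rfl, fun _ _ _ => Iff.rfl⟩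

theorem RootedIso.mem_ballSet {Γ : LabeledGraph L V} {u : V} {Δ : LabeledGraph L W} {v : W}
    {e : V ≃ W} (he : e u = v) (h : ∀ s x y, Γ.edge s x y ↔ Δ.edge s (e x) (e y)) (r : ℕ) (x : V)
    (hx : x ∈ Γ.ballSet u r) : e x ∈ Δ.ballSet v r := by
  let f : Γ.toSimpleGraph →g Δ.toSimpleGraph :=
    { toFun := e
      map_rel' := by
        intro a b hab
        rw [adj_iff] at hab ⊢
        simpa [← h] using hab }
  obtain ⟨p, hp⟩ := hx
  subst he
  exact ⟨p.map f, by simpa using hp⟩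

theorem RootedIso.ballIso {Γ : LabeledGraph L V} {u : V} {Δ : LabeledGraph L W} {v : W}
    (h : Γ.RootedIso u Δ v) (r : ℕ) : BallIso r Γ u Δ v := by
  obtain ⟨e, he, h⟩ := h
  have he' : e.symm v = u := by rw [← he, e.symm_apply_apply]
  have h' : ∀ s x y, Δ.edge s x y ↔ Γ.edge s (e.symm x) (e.symm y) :=
    fun s x y => by rw [h]; simp
  refine ⟨{ toFun := fun x => ⟨e x, RootedIso.mem_ballSet he h r x x.2⟩
            invFun := fun x => ⟨e.symm x, RootedIso.mem_ballSet he' h' r x x.2⟩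
            left_inv := fun x => by simp
            right_inv := fun x => by simp }, ?_, ?_⟩
  · simp [he]
  · intro s x y
    exact h s _ _

/-! ### Graphs of actions -/

/-- The action of a word on a point, the last letter acting first. -/
def wordAct (act : L → V → V) (w : List L) (x : V) : V := w.foldr act x

@[simp] theorem wordAct_nil (act : L → V → V) (x : V) : wordAct act [] x = x := rfl

@[simp] theorem wordAct_cons (act : L → V → V) (s : L) (w : List L) (x : V) :
    wordAct act (s :: w) x = act s (wordAct act w x) := rfl

theorem wordAct_append (act : L → V → V) (w w' : List L) (x : V) :
    wordAct act (w ++ w') x = wordAct act w (wordAct act w' x) :=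
  List.foldr_append

theorem wordAct_semiconj {act : L → V → V} {act' : L → W → W} {f : V → W}
    (h : ∀ s x, f (act s x) = act' s (f x)) (w : List L) (x : V) :
    f (wordAct act w x) = wordAct act' w (f x) := by
  induction w with
  | nil => rfl
  | cons s w ih => rw [wordAct_cons, h, ih, wordAct_cons]

/-- The formal inverse of a word. -/
def invWord (ι : L → L) (w : List L) : List L := (w.map ι).reverse

@[simp] theorem length_invWord (ι : L → L) (w : List L) : (invWord ι w).length = w.length := by
  simp [invWord]

theorem wordAct_invWord {act : L → V → V} {ι : L → L} (h : ∀ s x, act (ι s) (act s x) = x)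
    (w : List L) (x : V) : wordAct act (invWord ι w) (wordAct act w x) = x := by
  induction w with
  | nil => rfl
  | cons s w ih =>
    have : invWord ι (s :: w) = invWord ι w ++ [ι s] := by simp [invWord]
    rw [this, wordAct_append, wordAct_cons, wordAct_cons, wordAct_nil, h, ih]

theorem wordAct_injective {act : L → V → V} {ι : L → L} (h : ∀ s x, act (ι s) (act s x) = x)
    (w : List L) : Function.Injective (wordAct act w) := fun x y hxy => by
  rw [← wordAct_invWord h w x, hxy, wordAct_invWord h]

/-- `Γ` is the graph of the maps `act s`, where `act (ι s)` is the inverse of `act s`. -/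
structure IsActionGraph (Γ : LabeledGraph L V) (act : L → V → V) (ι : L → L) : Prop where
  edge_iff : ∀ s x y, Γ.edge s x y ↔ y = act s x
  inv_act : ∀ s x, act (ι s) (act s x) = x

variable {Γ : LabeledGraph L V} {Δ : LabeledGraph L W} {act : L → V → V} {act' : L → W → W}
  {ι : L → L} {u : V} {v : W}

theorem IsActionGraph.wordAct_mem_ballSet (hΓ : Γ.IsActionGraph act ι) (u : V) {w : List L}
    {r : ℕ} (hw : w.length ≤ r) : wordAct act w u ∈ Γ.ballSet u r := by
  induction w generalizing r with
  | nil => exact mem_ballSet_self _ _ _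
  | cons s w ih =>
    rw [List.length_cons] at hw
    obtain ⟨r, rfl⟩ : ∃ r', r = r' + 1 := ⟨r - 1, by omega⟩
    exact mem_ballSet_of_edge (ih (by omega)) (Or.inl ((hΓ.edge_iff s _ _).mpr rfl))

theorem IsActionGraph.edge_iff' (hΓ : Γ.IsActionGraph act ι) {s : L} {x y : V}
    (h : Γ.edge s x y) : x = act (ι s) y := by
  rw [(hΓ.edge_iff s x y).mp h, hΓ.inv_act]

theorem IsActionGraph.mem_ballSet_iff (hΓ : Γ.IsActionGraph act ι) {r : ℕ} {x : V} :
    x ∈ Γ.ballSet u r ↔ ∃ w : List L, w.length ≤ r ∧ wordAct act w u = x := by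
  constructor
  · intro hx
    induction r generalizing x with
    | zero => exact ⟨[], le_rfl, (mem_ballSet_zero.mp hx).symm⟩
    | succ r ih =>
      rcases exists_adj_of_mem_ballSet_succ hx with hx | ⟨y, hy, hadj⟩
      · obtain ⟨w, hw, hwx⟩ := ih hx
        exact ⟨w, by omega, hwx⟩
      · obtain ⟨w, hw, rfl⟩ := ih hy
        rcases (adj_iff _ _ _).mp hadj with ⟨-, ⟨s, hs⟩ | ⟨s, hs⟩⟩
        · exact ⟨s :: w, by simpa using hw, ((hΓ.edge_iff s _ _).mp hs).symm⟩
        · exact ⟨ι s :: w, by simpa using hw, (hΓ.edge_iff' hs).symm⟩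
  · rintro ⟨w, hw, rfl⟩
    exact hΓ.wordAct_mem_ballSet u hw

theorem IsActionGraph.exists_wordAct_eq (hΓ : Γ.IsActionGraph act ι)
    (hc : Γ.toSimpleGraph.Connected) (u x : V) : ∃ w, wordAct act w u = x := by
  obtain ⟨p⟩ := hc.preconnected u x
  obtain ⟨w, -, hw⟩ := hΓ.mem_ballSet_iff.mp (⟨p, le_rfl⟩ : x ∈ Γ.ballSet u p.length)
  exact ⟨w, hw⟩

/-- Two induced subgraphs consisting of the endpoints of a set `P` of words are isomorphic when
the two actions agree on which words of `P` have the same endpoint, and on the edges between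
such endpoints. -/
theorem IsActionGraph.rootedIso_induce (hΓ : Γ.IsActionGraph act ι)
    (hΔ : Δ.IsActionGraph act' ι) {P : Set (List L)} (hP : [] ∈ P) {A : Set V} {B : Set W}
    (hA : ∀ x, x ∈ A ↔ ∃ w ∈ P, wordAct act w u = x)
    (hB : ∀ x, x ∈ B ↔ ∃ w ∈ P, wordAct act' w v = x)
    (h : ∀ w ∈ P, ∀ w' ∈ P, wordAct act w u = wordAct act w' u ↔
      wordAct act' w v = wordAct act' w' v)
    (h' : ∀ s, ∀ w ∈ P, ∀ w' ∈ P, wordAct act w u = act s (wordAct act w' u) ↔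
      wordAct act' w v = act' s (wordAct act' w' v)) :
    RootedIso (Γ.induce A) ⟨u, (hA u).mpr ⟨[], hP, rfl⟩⟩
      (Δ.induce B) ⟨v, (hB v).mpr ⟨[], hP, rfl⟩⟩ := by
  choose f hf hfx using fun x : A => (hA x).mp x.2
  let g : A → B := fun x => ⟨wordAct act' (f x) v, (hB _).mpr ⟨f x, hf x, rfl⟩⟩
  have hg : Function.Bijective g := by
    constructor
    · intro x y hxy
      have := (h _ (hf x) _ (hf y)).mpr (congrArg Subtype.val hxy)
      rw [hfx, hfx] at this
      exact Subtype.ext this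
    · rintro ⟨y, hy⟩
      obtain ⟨w, hw, rfl⟩ := (hB y).mp hy
      refine ⟨⟨wordAct act w u, (hA _).mpr ⟨w, hw, rfl⟩⟩, Subtype.ext ?_⟩
      exact (h _ (hf _) _ hw).mp (hfx _)
  refine ⟨Equiv.ofBijective g hg, Subtype.ext ?_, ?_⟩
  · exact (h _ (hf _) [] hP).mp (hfx _)
  · intro s x y
    change Γ.edge s x y ↔ Δ.edge s (wordAct act' (f x) v) (wordAct act' (f y) v)
    rw [hΓ.edge_iff, hΔ.edge_iff, ← h' s _ (hf y) _ (hf x), hfx, hfx]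

theorem IsActionGraph.wordAct_eq_iff (hΓ : Γ.IsActionGraph act ι) (w w' : List L) (u : V) :
    wordAct act w u = wordAct act w' u ↔ wordAct act (invWord ι w' ++ w) u = u := by
  rw [wordAct_append, ← (wordAct_injective hΓ.inv_act (invWord ι w')).eq_iff,
    wordAct_invWord hΓ.inv_act]

/-- Comparing the endpoints of two words of length at most `r`, possibly with one edge in between,
means testing whether a word of length at most `2 * r + 1` closes up at the root. -/
theorem IsActionGraph.ballIso (hΓ : Γ.IsActionGraph act ι) (hΔ : Δ.IsActionGraph act' ι) (r : ℕ)
    (h : ∀ w : List L, w.length ≤ 2 * r + 1 → (wordAct act w u = u ↔ wordAct act' w v = v)) :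
    BallIso r Γ u Δ v := by
  refine hΓ.rootedIso_induce hΔ (P := {w | w.length ≤ r}) (Nat.zero_le r)
    (fun x => hΓ.mem_ballSet_iff) (fun x => hΔ.mem_ballSet_iff) ?_ ?_
  · intro w hw w' hw'
    rw [hΓ.wordAct_eq_iff, hΔ.wordAct_eq_iff]
    simp only [mem_ofPred_eq] at hw hw'
    exact h _ (by simp; omega)
  · intro s w hw w' hw'
    rw [← wordAct_cons act, ← wordAct_cons act', hΓ.wordAct_eq_iff, hΔ.wordAct_eq_iff]
    simp only [mem_ofPred_eq] at hw hw'
    exact h _ (by simp; omega)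

theorem IsActionGraph.rootedIso (hΓ : Γ.IsActionGraph act ι) (hΔ : Δ.IsActionGraph act' ι)
    (hcΓ : Γ.toSimpleGraph.Connected) (hcΔ : Δ.toSimpleGraph.Connected)
    (h : ∀ w : List L, wordAct act w u = u ↔ wordAct act' w v = v) : Γ.RootedIso u Δ v := by
  have h1 := hΓ.rootedIso_induce hΔ (u := u) (v := v) (P := univ) (A := univ) (B := univ) trivial
    (fun x => by simpa using hΓ.exists_wordAct_eq hcΓ u x)
    (fun x => by simpa using hΔ.exists_wordAct_eq hcΔ v x)
    (fun w _ w' _ => by rw [hΓ.wordAct_eq_iff, hΔ.wordAct_eq_iff, h])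
    (fun s w _ w' _ => by
      rw [← wordAct_cons act, ← wordAct_cons act', hΓ.wordAct_eq_iff, hΔ.wordAct_eq_iff, h])
  exact ((RootedIso.induce_univ Γ u fun _ => trivial).symm.trans h1).trans
    (RootedIso.induce_univ Δ v fun _ => trivial)

/-- Edges determine their targets, so a ball isomorphism is forced to carry the endpoint of a word
to the endpoint of the same word. -/
theorem BallIso.wordAct_eq_iff {r : ℕ} (h : BallIso r Γ u Δ v) (hΓ : Γ.IsActionGraph act ι)
    (hΔ : Δ.IsActionGraph act' ι) {w : List L} (hw : w.length ≤ r) :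
    wordAct act w u = u ↔ wordAct act' w v = v := by
  obtain ⟨e, he, h⟩ := h
  have key : ∀ w : List L, (hw : w.length ≤ r) →
      (e ⟨wordAct act w u, hΓ.wordAct_mem_ballSet u hw⟩).1 = wordAct act' w v := by
    intro w
    induction w with
    | nil => intro _; exact congrArg Subtype.val he
    | cons s w ih =>
      intro hw
      rw [List.length_cons] at hw
      have h1 := (h s ⟨wordAct act w u, hΓ.wordAct_mem_ballSet u (by omega)⟩
        ⟨wordAct act (s :: w) u, hΓ.wordAct_mem_ballSet u hw⟩).mp ((hΓ.edge_iff s _ _).mpr rfl)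
      have h2 := (hΔ.edge_iff s _ _).mp h1
      rw [h2, ih (by omega), wordAct_cons]
  have he' := congrArg Subtype.val he
  rw [← key w hw]
  constructor
  · intro hu
    refine Eq.trans (congrArg (fun x => (e x).1) (Subtype.ext hu)) he'
  · intro hv
    have := e.injective (Subtype.ext (hv.trans he'.symm))
    exact congrArg Subtype.val this

/-- A connected graph all of whose balls look like those of the graph of an action is the graph
of an action. -/
theorem IsActionGraph.exists_of_ballIso (hΓ : Γ.IsActionGraph act ι)
    (hc : Δ.toSimpleGraph.Connected) (h : ∀ r, BallIso r Γ u Δ v) :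
    ∃ act' : L → W → W, Δ.IsActionGraph act' ι := by
  have key : ∀ s x, ∃ y, ∀ z, (Δ.edge s x z ↔ z = y) ∧ (Δ.edge (ι s) y z ↔ z = x) := by
    intro s x
    obtain ⟨p⟩ := hc.preconnected v x
    have hx : x ∈ Δ.ballSet v p.length := ⟨p, le_rfl⟩
    -- The radius leaves room for `x`, its `s`-neighbour, and any further neighbour of that one.
    obtain ⟨e, he, h⟩ := h (p.length + 2)
    have he' : e.symm ⟨v, Δ.mem_ballSet_self v _⟩ = ⟨u, Γ.mem_ballSet_self u _⟩ := by
      rw [← he, e.symm_apply_apply]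
    have h' : ∀ s x y, (Δ.induce _).edge s x y ↔ (Γ.induce _).edge s (e.symm x) (e.symm y) :=
      fun s x y => by rw [h]; simp
    let x' : Δ.ballSet v (p.length + 2) := ⟨x, ballSet_mono _ _ (by omega) hx⟩
    have hx' := mem_ballSet_of_ballIso he' h' (k := p.length) (by omega) (x := x') hx
    have hy1 := mem_ballSet_of_edge hx' (Or.inl ((hΓ.edge_iff s _ _).mpr rfl))
    let y₀ : Γ.ballSet u (p.length + 2) := ⟨_, ballSet_mono _ _ (Nat.le_succ _) hy1⟩
    have hy2 := mem_ballSet_of_ballIso he h (k := p.length + 1) (by omega) (x := y₀) hy1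
    refine ⟨(e y₀).1, fun z => ⟨⟨fun hz => ?_, ?_⟩, ⟨fun hz => ?_, ?_⟩⟩⟩
    · have hz1 := ballSet_mono _ _ (Nat.le_succ _) (mem_ballSet_of_edge hx (Or.inl hz))
      have h1 := (hΓ.edge_iff s _ _).mp ((h' s x' ⟨z, hz1⟩).mp hz)
      have h2 : e.symm ⟨z, hz1⟩ = y₀ := Subtype.ext h1
      rw [← h2, e.apply_symm_apply]
    · rintro rfl
      have := (h s (e.symm x') y₀).mp ((hΓ.edge_iff s _ _).mpr rfl)
      rw [e.apply_symm_apply] at this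
      exact this
    · have hz1 := mem_ballSet_of_edge hy2 (Or.inl hz)
      have h1 := (h' (ι s) (e y₀) ⟨z, hz1⟩).mp hz
      rw [e.symm_apply_apply] at h1
      have h1 := (hΓ.edge_iff _ _ _).mp h1
      rw [show y₀.1 = act s (e.symm x').1 from rfl, hΓ.inv_act] at h1
      exact congrArg Subtype.val (e.symm.injective (Subtype.ext h1))
    · rintro rfl
      have := (h (ι s) y₀ (e.symm x')).mp ((hΓ.edge_iff _ _ _).mpr (hΓ.inv_act _ _).symm)
      rw [e.apply_symm_apply] at this
      exact this
  choose act' h1 using key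
  exact ⟨act', fun s x y => (h1 s x y).1, fun s x => (((h1 s x _).2.mp
    (((h1 (ι s) (act' s x) _).1).mpr rfl)))⟩

/-- The isomorphisms of the balls need not be chosen compatibly: once `Δ` is known to be the graph
of an action, stabilisers alone produce a global isomorphism. -/
theorem IsActionGraph.rootedIso_of_ballIso (hΓ : Γ.IsActionGraph act ι)
    (hcΓ : Γ.toSimpleGraph.Connected) (hcΔ : Δ.toSimpleGraph.Connected)
    (h : ∀ r, BallIso r Γ u Δ v) : Γ.RootedIso u Δ v := by
  obtain ⟨act', hΔ⟩ := hΓ.exists_of_ballIso hcΔ h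
  exact hΓ.rootedIso hΔ hcΓ hcΔ fun w => (h w.length).wordAct_eq_iff hΓ hΔ le_rfl

end LabeledGraph

/-! ### The topology of the space of rooted graphs -/

namespace RootedGraph

variable {L : Type}

theorem toSpace_eq_iff {Γ Δ : RootedGraph L} :
    Γ.toSpace = Δ.toSpace ↔ Γ.graph.RootedIso Γ.root Δ.graph Δ.root :=
  Quotient.eq (r := RootedGraph.isoSetoid L)

theorem toSpace_mem_cylinder {Γ Δ : RootedGraph L} {r : ℕ} :
    Δ.toSpace ∈ Γ.cylinder r ↔ Γ.graph.BallIso r Γ.root Δ.graph Δ.root := by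
  constructor
  · rintro ⟨Δ', h, h'⟩
    exact h'.trans ((toSpace_eq_iff.mp h).symm.ballIso r)
  · exact fun h => ⟨Δ, rfl, h⟩

theorem exists_toSpace_eq (x : RootedGraphSpace L) : ∃ Γ : RootedGraph L, Γ.toSpace = x :=
  Quotient.exists_rep x

/-- Any point of a cylinder can serve as its centre, as for balls of an ultrametric. -/
theorem isTopologicalBasis_cylinder : TopologicalSpace.IsTopologicalBasis
    {U | ∃ (Γ : RootedGraph L) (r : ℕ), U = Γ.cylinder r} where
  exists_subset_inter := by
    rintro _ ⟨Γ, r, rfl⟩ _ ⟨Γ', r', rfl⟩ x ⟨hx, hx'⟩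
    obtain ⟨Δ, rfl⟩ := exists_toSpace_eq x
    rw [toSpace_mem_cylinder] at hx hx'
    refine ⟨_, ⟨Δ, max r r', rfl⟩, toSpace_mem_cylinder.mpr (.refl _ _ _), ?_⟩
    intro y hy
    obtain ⟨Θ, rfl⟩ := exists_toSpace_eq y
    rw [toSpace_mem_cylinder] at hy
    exact ⟨toSpace_mem_cylinder.mpr (hx.trans (hy.mono (le_max_left _ _))),
      toSpace_mem_cylinder.mpr (hx'.trans (hy.mono (le_max_right _ _)))⟩
  sUnion_eq := by
    refine eq_univ_of_forall fun x => ?_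
    obtain ⟨Δ, rfl⟩ := exists_toSpace_eq x
    exact ⟨_, ⟨Δ, 0, rfl⟩, toSpace_mem_cylinder.mpr (.refl _ _ _)⟩
  eq_generateFrom := rfl

theorem hasBasis_nhds_toSpace (Γ : RootedGraph L) :
    (𝓝 Γ.toSpace).HasBasis (fun _ : ℕ => True) Γ.cylinder := by
  refine ⟨fun t => ?_⟩
  rw [isTopologicalBasis_cylinder.mem_nhds_iff]
  constructor
  · rintro ⟨_, ⟨Δ, r, rfl⟩, h, ht⟩
    refine ⟨r, trivial, fun y hy => ht ?_⟩
    obtain ⟨Θ, rfl⟩ := exists_toSpace_eq y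
    rw [toSpace_mem_cylinder] at *
    exact h.trans hy
  · rintro ⟨r, -, h⟩
    exact ⟨_, ⟨Γ, r, rfl⟩, toSpace_mem_cylinder.mpr (.refl _ _ _), h⟩

theorem isOpen_cylinder (Γ : RootedGraph L) (r : ℕ) : IsOpen (Γ.cylinder r) :=
  isTopologicalBasis_cylinder.isOpen ⟨Γ, r, rfl⟩

theorem tendsto_toSpace_iff {α : Type*} {l : Filter α} {f : α → RootedGraph L}
    {Γ : RootedGraph L} : Filter.Tendsto (fun a => (f a).toSpace) l (𝓝 Γ.toSpace) ↔
      ∀ r, ∀ᶠ a in l, Γ.graph.BallIso r Γ.root (f a).graph (f a).root := by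
  simp [Γ.hasBasis_nhds_toSpace.tendsto_right_iff, toSpace_mem_cylinder]

/-- Limits in the space of rooted graphs are unique if one of them is the graph of an action. -/
theorem eq_of_tendsto {α : Type*} {l : Filter α} [l.NeBot] {f : α → RootedGraphSpace L}
    {Γ : RootedGraph L} {act : L → Γ.V → Γ.V} {ι : L → L} (hΓ : Γ.graph.IsActionGraph act ι)
    {x : RootedGraphSpace L} (h : Filter.Tendsto f l (𝓝 Γ.toSpace))
    (hx : Filter.Tendsto f l (𝓝 x)) : x = Γ.toSpace := by
  obtain ⟨Δ, rfl⟩ := exists_toSpace_eq x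
  refine (toSpace_eq_iff.mpr (hΓ.rootedIso_of_ballIso Γ.connected Δ.connected fun r => ?_)).symm
  obtain ⟨a, ha, ha'⟩ := ((Γ.hasBasis_nhds_toSpace.tendsto_right_iff.mp h r trivial).and
    (Δ.hasBasis_nhds_toSpace.tendsto_right_iff.mp hx r trivial)).exists
  obtain ⟨Θ, hΘ⟩ := exists_toSpace_eq (f a)
  rw [← hΘ, toSpace_mem_cylinder] at ha ha'
  exact ha.trans ha'.symm

end RootedGraph

namespace Spinal

open LabeledGraph

variable {d m : ℕ}

/-! ### The extended action -/

/-- The label of the inverse of a generator. -/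
def labelInv : Label d m → Label d m
  | Sum.inl j => Sum.inl ⟨-j.1, neg_ne_zero.mpr j.2⟩
  | Sum.inr b => Sum.inr ⟨-b.1, neg_ne_zero.mpr b.2⟩

open Classical in
/-- The action of the generators on `d` copies of the boundary, where `b` moves the point
`(d-1)^ℕ` of the `i`-th copy to that of the copy `i + π b`. -/
noncomputable def extAct (ω : ℕ → Epi d m) (π : B d m →+ ZMod d) :
    Label d m → Boundary d × ZMod d → Boundary d × ZMod d
  | Sum.inl j, p => (rot j.1 p.1, p.2)
  | Sum.inr b, p => (spine ω b.1 p.1, if p.1 = lastRay d then p.2 + π b.1 else p.2)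

/-- The action of the generators on the boundary. -/
noncomputable def bdAct (ω : ℕ → Epi d m) (s : Label d m) (η : Boundary d) : Boundary d :=
  labelPerm ω s η

theorem extAct_fst (ω : ℕ → Epi d m) (π : B d m →+ ZMod d) (s : Label d m)
    (p : Boundary d × ZMod d) : (extAct ω π s p).1 = bdAct ω s p.1 := by
  rcases s with j | b <;> rfl

theorem extAct_zero_snd (ω : ℕ → Epi d m) (s : Label d m) (p : Boundary d × ZMod d) :
    (extAct ω 0 s p).2 = p.2 := by
  rcases s with j | b <;> simp [extAct]

theorem wordAct_extAct_fst (ω : ℕ → Epi d m) (π : B d m →+ ZMod d) (w : List (Label d m))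
    (p : Boundary d × ZMod d) : (wordAct (extAct ω π) w p).1 = wordAct (bdAct ω) w p.1 :=
  wordAct_semiconj (f := Prod.fst) (extAct_fst ω π) w p

/-- For `π = 0` the copies do not interact, so the extended action contains the ordinary one. -/
theorem wordAct_extAct_zero (ω : ℕ → Epi d m) (w : List (Label d m)) (p : Boundary d × ZMod d) :
    wordAct (extAct ω 0) w p = (wordAct (bdAct ω) w p.1, p.2) := by
  induction w with
  | nil => rfl
  | cons s w ih =>
    rw [wordAct_cons, ih]
    exact Prod.ext (extAct_fst _ _ _ _) (extAct_zero_snd _ _ _)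

theorem bdAct_inv (ω : ℕ → Epi d m) (s : Label d m) (η : Boundary d) :
    bdAct ω (labelInv s) (bdAct ω s η) = η := by
  rcases s with j | b
  · exact (rot j.1).left_inv η
  · refine spineFun_inv _ _ (fun n => ?_) η
    rw [map_neg, add_neg_cancel]

theorem spine_apply_succ_of_not (ω : ℕ → Epi d m) (b : B d m) {η : Boundary d} {n : ℕ}
    (h : ¬((∀ k < n, η k = -1) ∧ η n = 0)) : spine ω b η (n + 1) = η (n + 1) := by
  change spineFun (fun n => (ω n).1 b) η (n + 1) = _
  simp only [spineFun, if_neg h]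

theorem spine_apply_succ (ω : ℕ → Epi d m) (b : B d m) {η : Boundary d} {n : ℕ}
    (h : ∀ k < n, η k = -1) (h0 : η n = 0) : spine ω b η (n + 1) = η (n + 1) + (ω n).1 b := by
  change spineFun (fun n => (ω n).1 b) η (n + 1) = _
  simp only [spineFun, if_pos (And.intro h h0)]

theorem spine_eq_self (ω : ℕ → Epi d m) (b : B d m) {η : Boundary d}
    (h : ∀ n, ¬((∀ k < n, η k = -1) ∧ η n = 0)) : spine ω b η = η := by
  funext n
  cases n with
  | zero => rfl
  | succ n => exact spine_apply_succ_of_not ω b (h n)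

/-- The sequence `η` with the letter `x` put in front. -/
def cons (x : ZMod d) (η : Boundary d) : Boundary d
  | 0 => x
  | n + 1 => η n

@[simp] theorem cons_zero (x : ZMod d) (η : Boundary d) : cons x η 0 = x := rfl

@[simp] theorem cons_succ (x : ZMod d) (η : Boundary d) (n : ℕ) : cons x η (n + 1) = η n := rfl

theorem cons_head_tail (η : Boundary d) : cons (η 0) (fun n => η (n + 1)) = η := by
  funext n
  cases n <;> rfl

theorem rot_cons (j x : ZMod d) (η : Boundary d) : rot j (cons x η) = cons (x + j) η := by
  funext n
  cases n <;> rfl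

theorem cons_eq_lastRay {η : Boundary d} : cons (-1) η = lastRay d ↔ η = lastRay d := by
  constructor
  · intro h
    funext n
    exact congrFun h (n + 1)
  · rintro rfl
    funext n
    cases n <;> rfl

theorem extAct_inr_of_ne (ω : ℕ → Epi d m) (π : B d m →+ ZMod d) (b : {b : B d m // b ≠ 0})
    {p : Boundary d × ZMod d} (h : p.1 ≠ lastRay d) :
    extAct ω π (Sum.inr b) p = (spine ω b.1 p.1, p.2) := by
  simp only [extAct, if_neg h]

theorem exists_label_eq (π : Epi d m) {j : ZMod d} (hj : j ≠ 0) :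
    ∃ b : {b : B d m // b ≠ 0}, π.1 b.1 = j := by
  obtain ⟨b, rfl⟩ := π.2 j
  exact ⟨⟨b, fun h => hj (by rw [h, map_zero])⟩, rfl⟩

theorem exists_wordAct_of_reflTransGen (ω : ℕ → Epi d m) {P : Boundary d → Boundary d → Prop}
    {η η' : Boundary d}
    (h : Relation.ReflTransGen (fun x y => (∃ s, bdAct ω s x = y) ∧ P x y) η η') :
    ∃ w, wordAct (bdAct ω) w η = η' := by
  induction h with
  | refl => exact ⟨[], rfl⟩
  | tail _ h ih =>
    obtain ⟨w, rfl⟩ := ih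
    obtain ⟨⟨s, rfl⟩, -⟩ := h
    exact ⟨s :: w, rfl⟩

/-- The same words fix `p` and `p'`. -/
def SameStab (ω : ℕ → Epi d m) (π π' : B d m →+ ZMod d) (p p' : Boundary d × ZMod d) : Prop :=
  ∀ w, wordAct (extAct ω π) w p = p ↔ wordAct (extAct ω π') w p' = p'

variable {ω : ℕ → Epi d m} {π π' : B d m →+ ZMod d} {p p' : Boundary d × ZMod d}

/-- Rotations translate first letters and `B` fixes them, so the difference of two first letters is
invariant under simultaneous moves. -/
theorem wordAct_head_sub (w : List (Label d m)) :
    (wordAct (extAct ω π) w p).1 0 - (wordAct (extAct ω π') w p').1 0 = p.1 0 - p'.1 0 := by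
  induction w with
  | nil => rfl
  | cons s w ih =>
    rcases s with j | b
    · rw [← ih]
      exact add_sub_add_right_eq_sub _ _ _
    · exact ih

theorem exists_wordAct_head (x : ZMod d) : ∃ w, (wordAct (extAct ω π) w p).1 0 = x ∧
    ∀ (π' : B d m →+ ZMod d) (q : Boundary d × ZMod d) (n : ℕ),
      (wordAct (extAct ω π') w q).1 (n + 1) = q.1 (n + 1) := by
  by_cases h : x - p.1 0 = 0
  · exact ⟨[], (sub_eq_zero.mp h).symm, fun _ _ _ => rfl⟩
  · exact ⟨[Sum.inl ⟨_, h⟩], add_sub_cancel _ _, fun _ _ _ => rfl⟩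

theorem exists_ne_zero_of_mem_Omega (hω : ω ∈ Omega d m) {b : B d m} (hb : b ≠ 0) (i : ℕ) :
    ∃ j ≥ i, (ω j).1 b ≠ 0 := by
  by_contra! h
  have hmem : b ∈ ⨅ j ≥ i, (ω j).1.ker := by
    simp only [AddSubgroup.mem_iInf, AddMonoidHom.mem_ker]
    exact h
  rw [hω i, AddSubgroup.mem_bot] at hmem
  exact hb hmem

theorem shift_mem_Omega (hω : ω ∈ Omega d m) : (fun n => ω (n + 1)) ∈ Omega d m := by
  intro i
  rw [eq_bot_iff]
  intro b hb
  by_contra h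
  obtain ⟨j, hj, hbj⟩ := exists_ne_zero_of_mem_Omega hω h (i + 1)
  simp only [AddSubgroup.mem_iInf, AddMonoidHom.mem_ker] at hb
  obtain ⟨j, rfl⟩ : ∃ j', j = j' + 1 := ⟨j - 1, by omega⟩
  exact hbj (hb j (by omega))

theorem extAct_inr_eq_self (ω : ℕ → Epi d m) (π : B d m →+ ZMod d) (b : {b : B d m // b ≠ 0})
    {p : Boundary d × ZMod d} (h : p.1 0 ≠ 0) (h' : p.1 0 ≠ -1) :
    extAct ω π (Sum.inr b) p = p := by
  have : p.1 ≠ lastRay d := fun hp => h' (by rw [hp]; rfl)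
  rw [extAct_inr_of_ne _ _ _ this, spine_eq_self]
  rintro n ⟨h1, h2⟩
  cases n with
  | zero => exact h h2
  | succ n => exact h' (h1 0 (Nat.succ_pos n))

section Nontrivial

variable [Nontrivial (ZMod d)]

theorem neg_one_ne_zero' : (-1 : ZMod d) ≠ 0 := neg_ne_zero.mpr one_ne_zero

theorem spine_of_prefix (ω : ℕ → Epi d m) (b : B d m) {η : Boundary d} {n : ℕ}
    (h : ∀ k < n, η k = -1) (h0 : η n = 0) :
    spine ω b η = Function.update η (n + 1) (η (n + 1) + (ω n).1 b) := by
  funext k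
  cases k with
  | zero => rw [Function.update_of_ne (by omega)]; rfl
  | succ k =>
    rcases lt_trichotomy k n with hk | rfl | hk
    · rw [Function.update_of_ne (by omega)]
      exact spine_apply_succ_of_not _ _ fun hh => neg_one_ne_zero' ((h k hk).symm.trans hh.2)
    · rw [Function.update_self, spine_apply_succ _ _ h h0]
    · rw [Function.update_of_ne (by omega)]
      exact spine_apply_succ_of_not _ _ fun hh => neg_one_ne_zero' ((hh.1 n hk).symm.trans h0)

theorem spine_lastRay (ω : ℕ → Epi d m) (b : B d m) : spine ω b (lastRay d) = lastRay d :=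
  spine_eq_self _ _ fun _ h => neg_one_ne_zero' h.2

theorem spine_eq_lastRay (ω : ℕ → Epi d m) (b : B d m) {η : Boundary d} :
    spine ω b η = lastRay d ↔ η = lastRay d := by
  rw [← (spine ω b).injective.eq_iff (a := η), spine_lastRay]

theorem extAct_inv (ω : ℕ → Epi d m) (π : B d m →+ ZMod d) (s : Label d m)
    (p : Boundary d × ZMod d) : extAct ω π (labelInv s) (extAct ω π s p) = p := by
  refine Prod.ext (by rw [extAct_fst, extAct_fst, bdAct_inv]) ?_
  rcases s with j | b
  · rfl
  · simp only [extAct, labelInv, spine_eq_lastRay]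
    have h := spine_eq_lastRay ω b.1 (η := p.1)
    split_ifs with h1 h2 h2
    · simp
    · exact absurd (h.mp h1) h2
    · exact absurd (h.mpr h2) h1
    · rfl

theorem not_lastRay_of_zero {η : Boundary d} {n : ℕ} (h0 : η n = 0) : η ≠ lastRay d := by
  rintro rfl
  exact neg_one_ne_zero' h0

theorem extAct_inr_eq_self_iff (ω : ℕ → Epi d m) (π : B d m →+ ZMod d)
    (b : {b : B d m // b ≠ 0}) {p : Boundary d × ZMod d} {n : ℕ} (h : ∀ k < n, p.1 k = -1)
    (h0 : p.1 n = 0) : extAct ω π (Sum.inr b) p = p ↔ (ω n).1 b.1 = 0 := by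
  rw [extAct_inr_of_ne _ _ _ (not_lastRay_of_zero h0), Prod.ext_iff, spine_of_prefix _ _ h h0]
  simp

theorem extAct_inr_lastRay (ω : ℕ → Epi d m) (π : B d m →+ ZMod d) (b : {b : B d m // b ≠ 0})
    {p : Boundary d × ZMod d} (h : p.1 = lastRay d) :
    extAct ω π (Sum.inr b) p = (p.1, p.2 + π b.1) := by
  simp only [extAct, if_pos h]
  rw [h, spine_lastRay]

/-! ### Self-similarity -/

theorem spine_cons_neg_one (ω : ℕ → Epi d m) (b : B d m) (η : Boundary d) :
    spine ω b (cons (-1) η) = cons (-1) (spine (fun n => ω (n + 1)) b η) := by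
  funext n
  rcases n with _ | _ | n
  · rfl
  · exact spine_apply_succ_of_not _ _ fun h => neg_one_ne_zero' h.2
  · by_cases h : (∀ k < n, η k = -1) ∧ η n = 0
    · refine (spine_apply_succ ω b (η := cons (-1) η) (n := n + 1) ?_ h.2).trans
        (spine_apply_succ (fun n => ω (n + 1)) b h.1 h.2).symm
      · rintro (_ | k) hk
        · rfl
        · exact h.1 k (by omega)
    · refine (spine_apply_succ_of_not ω b (η := cons (-1) η) (n := n + 1) ?_).trans
        (spine_apply_succ_of_not (fun n => ω (n + 1)) b h).symm
      exact fun hh => h ⟨fun k hk => hh.1 (k + 1) (by omega), hh.2⟩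

theorem spine_cons_zero (ω : ℕ → Epi d m) (b : B d m) (η : Boundary d) :
    spine ω b (cons 0 η) = cons 0 (rot ((ω 0).1 b) η) := by
  rw [spine_of_prefix ω b (n := 0) (fun k hk => absurd hk (Nat.not_lt_zero k)) rfl]
  funext n
  rcases n with _ | _ | n <;> rfl

/-- A word acting on the sequences starting with `d-1` as the given generator of the shifted
group acts on their tails. -/
noncomputable def liftLabel (ω : ℕ → Epi d m) : Label d m → List (Label d m)
  -- The last letter acts first: the head `-1` is rotated to `0`, some `b` with `ω 0` value `j` adds
  -- `j` to the next letter, and the head is rotated back.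
  | Sum.inl j => [Sum.inl ⟨-1, neg_one_ne_zero'⟩, Sum.inr (exists_label_eq (ω 0) j.2).choose,
      Sum.inl ⟨1, one_ne_zero⟩]
  | Sum.inr b => [Sum.inr b]

theorem wordAct_liftLabel (ω : ℕ → Epi d m) (π : B d m →+ ZMod d) (s : Label d m)
    (p : Boundary d × ZMod d) :
    wordAct (extAct ω π) (liftLabel ω s) (Prod.map (cons (-1)) id p) =
      Prod.map (cons (-1)) id (extAct (fun n => ω (n + 1)) π s p) := by
  rcases s with j | b
  · have h := (exists_label_eq (ω 0) j.2).choose_spec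
    have hne : (cons 0 p.1 : Boundary d) ≠ lastRay d := not_lastRay_of_zero (n := 0) rfl
    simp [liftLabel, extAct, rot_cons, spine_cons_zero, h, hne]
  · refine Prod.ext (spine_cons_neg_one ω b.1 p.1) ?_
    by_cases hp : p.1 = lastRay d
    · exact (if_pos (cons_eq_lastRay.mpr hp)).trans (if_pos hp).symm
    · exact (if_neg fun h => hp (cons_eq_lastRay.mp h)).trans (if_neg hp).symm

theorem wordAct_flatMap_liftLabel (ω : ℕ → Epi d m) (π : B d m →+ ZMod d)
    (w : List (Label d m)) (p : Boundary d × ZMod d) :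
    wordAct (extAct ω π) (w.flatMap (liftLabel ω)) (Prod.map (cons (-1)) id p) =
      Prod.map (cons (-1)) id (wordAct (extAct (fun n => ω (n + 1)) π) w p) := by
  induction w with
  | nil => rfl
  | cons s w ih =>
    rw [List.flatMap_cons, wordAct_append, ih, wordAct_liftLabel, wordAct_cons]

/-! ### Paths between cofinal sequences -/

theorem exists_bdAct_eq (ω : ℕ → Epi d m) {η η' : Boundary d} {n : ℕ} (h : ∀ k < n, η k = -1)
    (h0 : η n = 0) (h' : ∀ k, k ≠ n + 1 → η' k = η k) (hne : η ≠ η') :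
    ∃ s, bdAct ω s η = η' := by
  have hη' : η' = Function.update η (n + 1) (η' (n + 1)) := by
    funext k
    by_cases hk : k = n + 1
    · rw [hk, Function.update_self]
    · rw [Function.update_of_ne hk, h' k hk]
  have hj : η' (n + 1) - η (n + 1) ≠ 0 := by
    intro hj
    rw [sub_eq_zero.mp hj, Function.update_eq_self] at hη'
    exact hne hη'.symm
  obtain ⟨b, hb⟩ := exists_label_eq (ω n) hj
  refine ⟨Sum.inr b, ?_⟩
  change spine ω b.1 η = _
  rw [spine_of_prefix ω b.1 h h0, hb, add_sub_cancel, ← hη']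

/-- Induction in the manner of a Gray code: to alter one further letter, bring the letters before it
to the form `(d-1)^n 0`, apply one element of `B`, and then correct the prefix. No letter from
position `n` on changes along the path, which the study of ends relies on. -/
theorem reflTransGen_of_eventually_eq (ω : ℕ → Epi d m) {n : ℕ} {η η' : Boundary d}
    (h : ∀ k, n ≤ k → η k = η' k) :
    Relation.ReflTransGen (fun x y => (∃ s, bdAct ω s x = y) ∧ ∀ k, n ≤ k → x k = y k) η η' := by
  induction n generalizing η η' with
  | zero =>
    rw [show η = η' from funext fun k => h k (Nat.zero_le k)]
  | succ n ih =>
    by_cases hne : η = η'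
    · rw [hne]
    rcases n with _ | n
    · refine .single ⟨⟨Sum.inl ⟨η' 0 - η 0, fun h0 => hne ?_⟩, ?_⟩, h⟩
      · funext k
        cases k with
        | zero => exact (sub_eq_zero.mp h0).symm
        | succ k => exact h _ (by omega)
      · funext k
        cases k with
        | zero => exact add_sub_cancel _ _
        | succ k => exact h _ (by omega)
    · have key : ∀ {x y : Boundary d}, (∀ k, n + 1 ≤ k → x k = y k) →
          Relation.ReflTransGen
            (fun x y => (∃ s, bdAct ω s x = y) ∧ ∀ k, n + 1 + 1 ≤ k → x k = y k) x y :=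
        fun hxy => Relation.ReflTransGen.mono
          (fun _ _ hab => ⟨hab.1, fun k hk => hab.2 k (by omega)⟩) _ _ (ih hxy)
      -- `μ` replaces the letters up to position `n` by `(d-1)^n 0`, so that `B` acts on letter `n +
      -- 1`.
      let μ : Boundary d → Boundary d := fun ζ k => if k < n then -1 else if k = n then 0 else ζ k
      have hμ : ∀ ζ k, n + 1 ≤ k → μ ζ k = ζ k := fun ζ k hk => by
        simp only [μ, if_neg (show ¬k < n by omega), if_neg (show ¬k = n by omega)]
      refine (key (y := μ η) fun k hk => (hμ η k hk).symm).trans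
        (.trans ?_ (key (x := μ η') fun k hk => hμ η' k hk))
      by_cases hne' : μ η = μ η'
      · rw [hne']
      refine .single ⟨exists_bdAct_eq ω (n := n) ?_ ?_ ?_ hne', ?_⟩
      · intro k hk
        simp only [μ, if_pos hk]
      · simp [μ]
      · intro k hk
        simp only [μ]
        split_ifs <;> first | rfl | exact (h k (by omega)).symm
      · intro k hk
        rw [hμ _ _ (by omega), hμ _ _ (by omega), h k hk]

theorem exists_wordAct_eq (ω : ℕ → Epi d m) {n : ℕ} {η η' : Boundary d}
    (h : ∀ k, n ≤ k → η k = η' k) : ∃ w, wordAct (bdAct ω) w η = η' :=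
  exists_wordAct_of_reflTransGen ω (reflTransGen_of_eventually_eq ω h)

theorem exists_bdAct_apply_eq (ω : ℕ → Epi d m) (s : Label d m) (η : Boundary d) :
    ∃ n, ∀ k, n ≤ k → bdAct ω s η k = η k := by
  rcases s with j | b
  · refine ⟨1, fun k hk => ?_⟩
    cases k with
    | zero => omega
    | succ k => rfl
  · by_cases h : ∃ n, (∀ k < n, η k = -1) ∧ η n = 0
    · obtain ⟨n, h, h0⟩ := h
      refine ⟨n + 2, fun k hk => ?_⟩
      change spine ω b.1 η k = _
      rw [spine_of_prefix ω b.1 h h0, Function.update_of_ne (by omega)]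
    · refine ⟨0, fun k _ => ?_⟩
      change spine ω b.1 η k = _
      rw [spine_eq_self ω b.1 fun n hn => h ⟨n, hn⟩]

theorem exists_wordAct_apply_eq (ω : ℕ → Epi d m) (w : List (Label d m)) (η : Boundary d) :
    ∃ n, ∀ k, n ≤ k → wordAct (bdAct ω) w η k = η k := by
  induction w with
  | nil => exact ⟨0, fun _ _ => rfl⟩
  | cons s w ih =>
    obtain ⟨n, hn⟩ := ih
    obtain ⟨n', hn'⟩ := exists_bdAct_apply_eq ω s (wordAct (bdAct ω) w η)
    exact ⟨max n n', fun k hk => (hn' k (by omega)).trans (hn k (by omega))⟩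

/-! ### Stabilisers determine points -/

/-- Moving both points by `w` conjugates both stabilisers by `w`. -/
theorem SameStab.wordAct (h : SameStab ω π π' p p') (w : List (Label d m)) :
    SameStab ω π π' (wordAct (extAct ω π) w p) (wordAct (extAct ω π') w p') := by
  have key : ∀ (π : B d m →+ ZMod d) (p : Boundary d × ZMod d) (v : List (Label d m)),
      LabeledGraph.wordAct (extAct ω π) v (LabeledGraph.wordAct (extAct ω π) w p) =
        LabeledGraph.wordAct (extAct ω π) w p ↔
      LabeledGraph.wordAct (extAct ω π) (invWord labelInv w ++ (v ++ w)) p = p := by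
    intro π p v
    rw [wordAct_append, wordAct_append,
      ← (wordAct_injective (extAct_inv ω π) (invWord labelInv w)).eq_iff,
      wordAct_invWord (extAct_inv ω π) w p]
  intro v
  rw [key, key, h]

theorem exists_ker_of_two_le [NeZero d] (hm : 2 ≤ m) (π : Epi d m) :
    ∃ b : B d m, b ≠ 0 ∧ π.1 b = 0 := by
  by_contra! h
  have hinj : Function.Injective π.1 :=
    (injective_iff_map_eq_zero π.1).mpr fun b hb => by_contra fun hb0 => h b hb0 hb
  have hcard := Nat.card_le_card_of_injective _ hinj
  have hd : 1 < d := by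
    have := NeZero.ne d
    have : d ≠ 1 := ZMod.nontrivial_iff.mp inferInstance
    omega
  rw [Nat.card_fun, Nat.card_zmod, Nat.card_fin] at hcard
  exact absurd hcard (not_le.mpr (by simpa using Nat.pow_lt_pow_right hd hm))

theorem eq_two_of_one_eq_neg_one [NeZero d] (h : (1 : ZMod d) = -1) : d = 2 := by
  have h2 : ((2 : ℕ) : ZMod d) = 0 := by
    push_cast
    rw [← one_add_one_eq_two]
    nth_rewrite 1 [h]
    exact neg_add_cancel 1
  have hd := Nat.le_of_dvd two_pos ((ZMod.natCast_eq_zero_iff 2 d).mp h2)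
  have := NeZero.ne d
  have : d ≠ 1 := ZMod.nontrivial_iff.mp inferInstance
  omega

/-- Every `b` fixes a point whose head is neither `0` nor `-1`, whereas some `b₁` moves all points
with head `0`. Unequal heads can therefore survive rotation only if `d = 2`. There an element of the
kernel of `ω 0` separates the points; a nonzero one exists because `2 ≤ m`. -/
theorem SameStab.head_eq [NeZero d] (hdm : (d = 2 ∧ 2 ≤ m) ∨ (3 ≤ d ∧ 1 ≤ m))
    (hω : ω ∈ Omega d m) (h : SameStab ω π π' p p') : p.1 0 = p'.1 0 := by
  by_contra hne
  have hfix : ∀ (w : List (Label d m)) (b : {b : B d m // b ≠ 0}),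
      extAct ω π (Sum.inr b) (LabeledGraph.wordAct (extAct ω π) w p) =
        LabeledGraph.wordAct (extAct ω π) w p ↔
      extAct ω π' (Sum.inr b) (LabeledGraph.wordAct (extAct ω π') w p') =
        LabeledGraph.wordAct (extAct ω π') w p' :=
    fun w b => h.wordAct w [Sum.inr b]
  obtain ⟨b₁, hb₁⟩ := exists_label_eq (ω 0) (one_ne_zero (α := ZMod d))
  have hdiff := fun w => wordAct_head_sub (ω := ω) (π := π) (π' := π') (p := p) (p' := p') w
  have hmove : ∀ (π : B d m →+ ZMod d) (q : Boundary d × ZMod d), q.1 0 = 0 →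
      extAct ω π (Sum.inr b₁) q ≠ q := by
    intro π q hq hh
    rw [extAct_inr_eq_self_iff ω π b₁ (n := 0) (fun k hk => absurd hk (Nat.not_lt_zero k)) hq,
      hb₁] at hh
    exact one_ne_zero hh
  -- Rotate `p` to head `0`, where `b₁` moves it. The image of `p'` has nonzero head and must be
  -- moved as well, so that head is `-1`.
  have hc : p.1 0 - p'.1 0 = 1 := by
    obtain ⟨w, hw, -⟩ := exists_wordAct_head (ω := ω) (π := π) (p := p) 0
    have h1 := hdiff w
    rw [hw, zero_sub] at h1
    by_contra hc
    refine hmove π _ hw ((hfix w b₁).mpr (extAct_inr_eq_self _ _ _ ?_ ?_))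
    · intro h0
      rw [h0, neg_zero] at h1
      exact hne (sub_eq_zero.mp h1.symm)
    · intro h0
      rw [h0, neg_neg] at h1
      exact hc h1.symm
  -- Now rotate `p` to head `1`, so that `p'` has head `0` and is moved. Then `p` must be moved too,
  -- which forces `1 = -1`.
  have hd : d = 2 := by
    obtain ⟨w, hw, -⟩ := exists_wordAct_head (ω := ω) (π := π) (p := p) 1
    have h1 := hdiff w
    rw [hw, hc, sub_eq_self] at h1
    refine eq_two_of_one_eq_neg_one (by_contra fun h2 => hmove π' _ h1 ((hfix w b₁).mp ?_))
    exact extAct_inr_eq_self _ _ _ (by rw [hw]; exact one_ne_zero) (by rw [hw]; exact h2)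
  have hm : 2 ≤ m := by omega
  -- `b₀` fixes all points with head `0`, but by the condition on `ω` it moves points with prefix
  -- `(d-1)^k 0` for some `k ≥ 1`. Bringing `p` to that form gives `p'` head `0`, since the heads
  -- differ by `1` modulo `2`.
  obtain ⟨b₀, hb₀, hk₀⟩ := exists_ker_of_two_le hm (ω 0)
  obtain ⟨k, hk, hbk⟩ := exists_ne_zero_of_mem_Omega hω hb₀ 1
  obtain ⟨w, hw⟩ := exists_wordAct_eq ω (n := k + 1) (η := p.1)
    (η' := fun n => if n < k then -1 else if n = k then 0 else p.1 n) fun n hn => by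
      rw [if_neg (by omega), if_neg (by omega)]
  rw [← wordAct_extAct_fst ω π] at hw
  have h1 := hdiff w
  rw [hc, hw] at h1
  simp only [if_pos (show 0 < k by omega)] at h1
  have h2 : (LabeledGraph.wordAct (extAct ω π') w p').1 0 = 0 := by
    subst hd
    have h3 : (2 : ZMod 2) = 0 := rfl
    linear_combination -h1 - h3
  refine hbk ((extAct_inr_eq_self_iff ω π ⟨b₀, hb₀⟩ (n := k) ?_ ?_).mp ((hfix w ⟨b₀, hb₀⟩).mpr
    ((extAct_inr_eq_self_iff ω π' _ (n := 0) (fun k hk => absurd hk (Nat.not_lt_zero k)) h2).mpr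
      hk₀)))
  · intro n hn
    rw [hw]
    exact if_pos hn
  · rw [hw]
    simp

/-- Lifted words act on points with head `d-1` as the original words of the shifted group act on
tails, so tail stabilisers can be read off from the full ones. -/
theorem SameStab.tail (h : SameStab ω π π' p p') (hp : p.1 0 = -1) (hp' : p'.1 0 = -1) :
    SameStab (fun n => ω (n + 1)) π π' (fun n => p.1 (n + 1), p.2)
      (fun n => p'.1 (n + 1), p'.2) := by
  have key : ∀ (π : B d m →+ ZMod d) (p : Boundary d × ZMod d), p.1 0 = -1 →
      ∀ w, LabeledGraph.wordAct (extAct ω π) (w.flatMap (liftLabel ω)) p = p ↔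
        LabeledGraph.wordAct (extAct (fun n => ω (n + 1)) π) w (fun n => p.1 (n + 1), p.2) =
          (fun n => p.1 (n + 1), p.2) := by
    intro π p hp w
    have h1 : p = Prod.map (cons (-1)) id ((fun n => p.1 (n + 1), p.2) : Boundary d × ZMod d) := by
      refine Prod.ext ?_ rfl
      rw [← cons_head_tail p.1, hp]
      rfl
    have hinj : Function.Injective (Prod.map (cons (-1)) id :
        Boundary d × ZMod d → Boundary d × ZMod d) :=
      Function.Injective.prodMap (fun x y hxy => funext fun n => congrFun hxy (n + 1))
        Function.injective_id
    conv_lhs => rw [h1]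
    rw [wordAct_flatMap_liftLabel]
    exact hinj.eq_iff
  intro w
  rw [← key π p hp, ← key π' p' hp', h]

/-- Rotate the heads to `d-1`, which leaves all other letters alone, and pass to tails; the shifted
sequence again lies in `Omega d m`. -/
theorem SameStab.apply_eq [NeZero d] (hdm : (d = 2 ∧ 2 ≤ m) ∨ (3 ≤ d ∧ 1 ≤ m))
    (hω : ω ∈ Omega d m) (h : SameStab ω π π' p p') (n : ℕ) : p.1 n = p'.1 n := by
  induction n generalizing ω p p' with
  | zero => exact h.head_eq hdm hω
  | succ n ih =>
    obtain ⟨w, hw, hwt⟩ := exists_wordAct_head (ω := ω) (π := π) (p := p) (-1)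
    have h1 := h.wordAct w
    have hw' := h1.head_eq hdm hω
    rw [hw] at hw'
    have h2 := ih (shift_mem_Omega hω) (h1.tail hw hw'.symm)
    simpa only [hwt] using h2

end Nontrivial
end Spinal

namespace Spinal

open LabeledGraph

variable {d m : ℕ}

/-! ### Schreier graphs and their limits as graphs of actions -/

theorem isActionGraph_schreierGraph (ω : ℕ → Epi d m) (ξ : Boundary d) :
    (schreierGraph ω ξ).IsActionGraph (fun s u => gen ω s • u) labelInv where
  edge_iff _ _ _ := Iff.rfl
  inv_act s u := Subtype.ext (bdAct_inv ω s u.1)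

theorem coe_wordAct_gen (ω : ℕ → Epi d m) {ξ : Boundary d} (w : List (Label d m))
    (u : MulAction.orbit (spinalGroup ω) ξ) :
    (wordAct (fun s u => gen ω s • u) w u).1 = wordAct (bdAct ω) w u.1 :=
  wordAct_semiconj (f := Subtype.val) (fun _ _ => rfl) w u

theorem mem_orbit_iff (ω : ℕ → Epi d m) {ξ η : Boundary d} :
    η ∈ MulAction.orbit (spinalGroup ω) ξ ↔ ∃ w, wordAct (bdAct ω) w ξ = η := by
  constructor
  · intro h
    obtain ⟨w, hw⟩ := (isActionGraph_schreierGraph ω ξ).exists_wordAct_eq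
      (orbitalSchreier_connected _ (closure_gen ω) ξ) ⟨ξ, MulAction.mem_orbit_self ξ⟩ ⟨η, h⟩
    exact ⟨w, by rw [← coe_wordAct_gen ω w ⟨ξ, MulAction.mem_orbit_self ξ⟩, hw]⟩
  · rintro ⟨w, rfl⟩
    rw [← coe_wordAct_gen ω w ⟨ξ, MulAction.mem_orbit_self ξ⟩]
    exact Subtype.prop _

/-- The action of the generators on the vertices of `tildeGamma ω π`. -/
noncomputable def tildeAct (ω : ℕ → Epi d m) (π : B d m →+ ZMod d) (s : Label d m)
    (p : MulAction.orbit (spinalGroup ω) (lastRay d) × ZMod d) :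
    MulAction.orbit (spinalGroup ω) (lastRay d) × ZMod d :=
  (gen ω s • p.1, (extAct ω π s (p.1.1, p.2)).2)

theorem coe_wordAct_tildeAct (ω : ℕ → Epi d m) (π : B d m →+ ZMod d) (w : List (Label d m))
    (p : MulAction.orbit (spinalGroup ω) (lastRay d) × ZMod d) :
    Prod.map Subtype.val id (wordAct (tildeAct ω π) w p) =
      wordAct (extAct ω π) w (p.1.1, p.2) :=
  wordAct_semiconj (f := Prod.map Subtype.val id)
    (act := tildeAct ω π) (act' := extAct ω π)
    (fun s p => Prod.ext (extAct_fst ω π s (p.1.1, p.2)).symm rfl) w p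

theorem wordAct_gen_eq_iff (ω : ℕ → Epi d m) {ξ : Boundary d} (w : List (Label d m))
    (u : MulAction.orbit (spinalGroup ω) ξ) (i : ZMod d) :
    wordAct (fun s u => gen ω s • u) w u = u ↔ wordAct (extAct ω 0) w (u.1, i) = (u.1, i) := by
  rw [Subtype.ext_iff, coe_wordAct_gen, wordAct_extAct_zero, Prod.ext_iff]
  simp

theorem wordAct_tildeAct_eq_iff (ω : ℕ → Epi d m) (π : B d m →+ ZMod d) (w : List (Label d m))
    (p : MulAction.orbit (spinalGroup ω) (lastRay d) × ZMod d) :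
    wordAct (tildeAct ω π) w p = p ↔
      wordAct (extAct ω π) w (p.1.1, p.2) = (p.1.1, p.2) := by
  rw [← coe_wordAct_tildeAct]
  exact (Function.Injective.prodMap Subtype.val_injective Function.injective_id).eq_iff.symm

/-! ### Approximation by boundary points -/

/-- The first `N` letters of `η`, followed by `τ`. -/
def glue (N : ℕ) (η τ : Boundary d) : Boundary d := fun k => if k < N then η k else τ (k - N)

theorem glue_of_lt {N k : ℕ} (h : k < N) (η τ : Boundary d) : glue N η τ k = η k := if_pos h

theorem glue_of_le {N k : ℕ} (h : N ≤ k) (η τ : Boundary d) : glue N η τ k = τ (k - N) :=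
  if_neg (not_lt.mpr h)

theorem glue_drop {N : ℕ} {η ξ : Boundary d} (h : ∀ k < N, ξ k = η k) :
    glue N η (fun k => ξ (k + N)) = ξ := by
  funext k
  by_cases hk : k < N
  · rw [glue_of_lt hk, h k hk]
  · rw [glue_of_le (not_lt.mp hk), Nat.sub_add_cancel (not_lt.mp hk)]

/-- The tails `τ i`, placed after a prefix `(d-1)^N`, are permuted by `B` through `π`. -/
def IsCompatible (ω : ℕ → Epi d m) (π : B d m →+ ZMod d) (N : ℕ) (τ : ZMod d → Boundary d) :
    Prop :=
  ∀ b i, spine ω b (glue N (lastRay d) (τ i)) = glue N (lastRay d) (τ (i + π b))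

theorem mem_Cof_lastRay {η : Boundary d} : η ∈ Cof (lastRay d) ↔ ∃ n, ∀ k, n ≤ k → η k = -1 :=
  exists_congr fun _ => forall₂_congr fun _ _ => eq_comm

variable {ω : ℕ → Epi d m} {π : B d m →+ ZMod d}

variable [Nontrivial (ZMod d)]

/-- A generator does not notice the seam at `N`. If some letter before position `N - 1` differs from
`d-1`, then `b` acts within the prefix or not at all; if the prefix is `(d-1)^N`, compatibility
turns its effect on the tail into a change of copy. -/
theorem bdAct_glue {p : Boundary d × ZMod d} {N : ℕ} (hN : 1 ≤ N) {τ : ZMod d → Boundary d}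
    (h : p.1 = lastRay d → IsCompatible ω π N τ)
    (h' : p.1 ≠ lastRay d → ∃ k, k + 1 < N ∧ p.1 k ≠ -1) (s : Label d m) :
    bdAct ω s (glue N p.1 (τ p.2)) =
      glue N (extAct ω π s p).1 (τ (extAct ω π s p).2) := by
  rcases s with j | b
  · funext k
    cases k with
    | zero =>
      rw [glue_of_lt (by omega)]
      change glue N p.1 (τ p.2) 0 + j.1 = p.1 0 + j.1
      rw [glue_of_lt (by omega)]
    | succ k => rfl
  · by_cases hp : p.1 = lastRay d
    · change spine ω b.1 _ = glue N (spine ω b.1 p.1) _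
      have h1 : (extAct ω π (Sum.inr b) p).2 = p.2 + π b.1 := if_pos hp
      have h2 : spine ω b.1 p.1 = lastRay d := (spine_eq_lastRay ω b.1).mpr hp
      rw [h1, h2, hp, h hp]
    · rw [extAct_inr_of_ne _ _ _ hp]
      obtain ⟨l, hl, hl'⟩ := h' hp
      change spine ω b.1 _ = glue N (spine ω b.1 p.1) (τ p.2)
      funext k
      cases k with
      | zero =>
        rw [glue_of_lt (by omega)]
        exact glue_of_lt (by omega) _ _
      | succ k =>
        have hiff : ((∀ n < k, glue N p.1 (τ p.2) n = -1) ∧ glue N p.1 (τ p.2) k = 0) ↔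
            k + 1 < N ∧ (∀ n < k, p.1 n = -1) ∧ p.1 k = 0 := by
          by_cases hk : k + 1 < N
          · rw [glue_of_lt (by omega)]
            refine ⟨fun hh => ⟨hk, fun n hn => ?_, hh.2⟩, fun hh => ⟨fun n hn => ?_, hh.2.2⟩⟩
            · rw [← hh.1 n hn, glue_of_lt (by omega)]
            · rw [← hh.2.1 n hn, glue_of_lt (by omega)]
          · refine iff_of_false (fun hh => hl' ?_) fun hh => hk hh.1
            rw [← hh.1 l (by omega), glue_of_lt (by omega)]
        by_cases hk : (∀ n < k, glue N p.1 (τ p.2) n = -1) ∧ glue N p.1 (τ p.2) k = 0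
        · obtain ⟨h1, h2, h3⟩ := hiff.mp hk
          rw [spine_apply_succ ω b.1 hk.1 hk.2, glue_of_lt h1, glue_of_lt h1,
            spine_apply_succ ω b.1 h2 h3]
        · rw [spine_apply_succ_of_not ω b.1 hk]
          by_cases h1 : k + 1 < N
          · rw [glue_of_lt h1, glue_of_lt h1, spine_apply_succ_of_not]
            exact fun hh => hk (hiff.mpr ⟨h1, hh⟩)
          · rw [glue_of_le (not_lt.mp h1), glue_of_le (not_lt.mp h1)]

/-- A word visits finitely many points, and each one other than `(d-1)^ℕ` has a letter different
from `d-1`; `N` is taken beyond these letters. The orbit of a point not cofinal to `(d-1)^ℕ` never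
meets it, so compatibility is then unnecessary. -/
theorem eventually_wordAct_glue (ω : ℕ → Epi d m) (π : B d m →+ ZMod d) (w : List (Label d m))
    (p : Boundary d × ZMod d) : ∀ᶠ N in Filter.atTop, ∀ τ : ZMod d → Boundary d,
      (p.1 ∉ Cof (lastRay d) ∨ IsCompatible ω π N τ) →
      wordAct (bdAct ω) w (glue N p.1 (τ p.2)) =
        glue N (wordAct (extAct ω π) w p).1 (τ (wordAct (extAct ω π) w p).2) := by
  induction w with
  | nil => exact Filter.Eventually.of_forall fun _ _ _ => rfl
  | cons s w ih =>
    have hev : ∀ᶠ N in Filter.atTop, (wordAct (extAct ω π) w p).1 ≠ lastRay d →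
        ∃ k, k + 1 < N ∧ (wordAct (extAct ω π) w p).1 k ≠ -1 := by
      by_cases hq : (wordAct (extAct ω π) w p).1 = lastRay d
      · exact Filter.Eventually.of_forall fun _ h => absurd hq h
      · obtain ⟨k, hk⟩ := Function.ne_iff.mp hq
        filter_upwards [Filter.eventually_gt_atTop (k + 1)] with N hN _ using ⟨k, hN, hk⟩
    filter_upwards [ih, hev, Filter.eventually_ge_atTop 1] with N h1 h2 h3 τ hτ
    rw [wordAct_cons, h1 τ hτ, bdAct_glue h3 (fun hq => hτ.resolve_left fun hp => hp ?_) h2 s]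
    · rfl
    · obtain ⟨n, hn⟩ := exists_wordAct_apply_eq ω w p.1
      refine mem_Cof_lastRay.mpr ⟨n, fun k hk => ?_⟩
      rw [← hn k hk, ← wordAct_extAct_fst ω π, hq]
      rfl

/-- There are finitely many words of length at most `r`, so one `N` serves them all. A glued point
determines the copy when `τ` is injective; when `π = 0` the copy never changes. -/
theorem eventually_wordAct_glue_eq_iff [NeZero d] (ω : ℕ → Epi d m) (π : B d m →+ ZMod d)
    (p : Boundary d × ZMod d) (r : ℕ) : ∀ᶠ N in Filter.atTop, ∀ τ : ZMod d → Boundary d,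
      (p.1 ∉ Cof (lastRay d) ∨ IsCompatible ω π N τ) → (π = 0 ∨ Function.Injective τ) →
      ∀ w : List (Label d m), w.length ≤ r → (wordAct (extAct ω π) w p = p ↔
        wordAct (bdAct ω) w (glue N p.1 (τ p.2)) = glue N p.1 (τ p.2)) := by
  have h : ∀ᶠ N in Filter.atTop, ∀ w ∈ {w : List (Label d m) | w.length ≤ r},
      (∀ τ : ZMod d → Boundary d, (p.1 ∉ Cof (lastRay d) ∨ IsCompatible ω π N τ) →
        wordAct (bdAct ω) w (glue N p.1 (τ p.2)) =
          glue N (wordAct (extAct ω π) w p).1 (τ (wordAct (extAct ω π) w p).2)) ∧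
      ∀ k, N ≤ k → wordAct (bdAct ω) w p.1 k = p.1 k := by
    rw [Filter.eventually_all_finite (List.finite_length_le _ _)]
    intro w _
    obtain ⟨n, hn⟩ := exists_wordAct_apply_eq ω w p.1
    filter_upwards [eventually_wordAct_glue ω π w p, Filter.eventually_ge_atTop n] with N h1 h2
    exact ⟨h1, fun k hk => hn k (h2.trans hk)⟩
  filter_upwards [h] with N hN τ hτ hτ' w hw
  obtain ⟨h1, h2⟩ := hN w hw
  rw [h1 τ hτ]
  constructor
  · intro h
    rw [h]
  · intro h
    refine Prod.ext (funext fun k => ?_) ?_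
    · by_cases hk : k < N
      · simpa only [glue_of_lt hk] using congrFun h k
      · rw [wordAct_extAct_fst, h2 k (not_lt.mp hk)]
    · rcases hτ' with rfl | hτ'
      · rw [wordAct_extAct_zero]
      · refine hτ' (funext fun k => ?_)
        simpa only [glue_of_le (Nat.le_add_left N k), Nat.add_sub_cancel] using
          congrFun h (k + N)

/-- Rotations move `(d-1)^ℕ` and `B` fixes it. The loops discarded there are thus exactly the edges
labelled by `B`, and those of `lambdaGraph π` take their place. -/
theorem isActionGraph_tildeGamma (ω : ℕ → Epi d m) (π : Epi d m) :
    (tildeGamma ω π).IsActionGraph (tildeAct ω π.1) labelInv where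
  edge_iff := by
    rintro s ⟨u, i⟩ ⟨v, j⟩
    change (i = j ∧ v = gen ω s • u ∧ ¬(u = ⟨lastRay d, MulAction.mem_orbit_self _⟩ ∧
        v = ⟨lastRay d, MulAction.mem_orbit_self _⟩)) ∨
      (u = ⟨lastRay d, MulAction.mem_orbit_self _⟩ ∧
        v = ⟨lastRay d, MulAction.mem_orbit_self _⟩ ∧ (lambdaGraph π).edge s i j) ↔
      (v, j) = (gen ω s • u, (extAct ω π.1 s (u.1, i)).2)
    rw [Prod.ext_iff]
    dsimp only
    rcases s with a | b
    · have hne : u.1 = lastRay d → (gen ω (Sum.inl a) • u).1 ≠ lastRay d := by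
        intro hu h
        have h0 := congrFun h 0
        change u.1 0 + a.1 = -1 at h0
        rw [hu] at h0
        exact a.2 (add_eq_left.mp h0)
      constructor
      · rintro (⟨rfl, h, -⟩ | ⟨-, -, h⟩)
        · exact ⟨h, rfl⟩
        · exact h.elim
      · rintro ⟨h, rfl⟩
        refine Or.inl ⟨rfl, h, fun hh => hne (congrArg Subtype.val hh.1) ?_⟩
        rw [← h]
        exact congrArg Subtype.val hh.2
    · have hfix : u = ⟨lastRay d, MulAction.mem_orbit_self _⟩ →
          gen ω (Sum.inr b) • u = ⟨lastRay d, MulAction.mem_orbit_self _⟩ := fun hu =>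
        Subtype.ext ((spine_eq_lastRay ω b.1).mpr (congrArg Subtype.val hu))
      by_cases hu : u = ⟨lastRay d, MulAction.mem_orbit_self _⟩
      · have h2 : (extAct ω π.1 (Sum.inr b) (u.1, i)).2 = i + π.1 b.1 :=
          if_pos (congrArg Subtype.val hu)
        rw [h2]
        constructor
        · rintro (⟨-, h, hh⟩ | ⟨-, h, hh⟩)
          · exact absurd ⟨hu, h.trans (hfix hu)⟩ hh
          · exact ⟨h.trans (hfix hu).symm, hh⟩
        · rintro ⟨h, hh⟩
          exact Or.inr ⟨hu, h.trans (hfix hu), hh⟩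
      · have h2 : (extAct ω π.1 (Sum.inr b) (u.1, i)).2 = i :=
          if_neg fun h => hu (Subtype.ext h)
        rw [h2]
        constructor
        · rintro (⟨h, hh, -⟩ | ⟨h, -⟩)
          · exact ⟨hh, h.symm⟩
          · exact absurd h hu
        · rintro ⟨h, hh⟩
          exact Or.inl ⟨hh.symm, h, fun hh => hu hh.1⟩
  inv_act s p := by
    refine Prod.ext ((isActionGraph_schreierGraph ω _).inv_act s p.1) ?_
    have h := congrArg Prod.snd (extAct_inv ω π.1 s (p.1.1, p.2))
    rwa [show extAct ω π.1 s (p.1.1, p.2) =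
      (bdAct ω s p.1.1, (extAct ω π.1 s (p.1.1, p.2)).2) from
        Prod.ext (extAct_fst ω π.1 s (p.1.1, p.2)) rfl] at h

end Spinal

/-! ### Counting ends -/

/-- If the complements of an exhausting sequence of finite sets of vertices have as components
the fibres of a map `c`, each of which is unbounded, then the ends correspond to the values
of `c`. -/
theorem SimpleGraph.card_end_eq {V : Type*} {I : Type*} (G : SimpleGraph V) {K : ℕ → Finset V}
    (hK : Monotone K) (hex : ∀ v, ∃ n, v ∈ K n) (c : V → I)
    (hadj : ∀ n x y, x ∉ K n → y ∉ K n → G.Adj x y → c x = c y)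
    (hconn : ∀ n x y, (hx : x ∉ (K n : Set V)) → (hy : y ∉ (K n : Set V)) → c x = c y →
      G.componentComplMk hx = G.componentComplMk hy)
    (hne : ∀ n i, ∃ x ∉ K n, c x = i) : Nat.card G.end = Nat.card I := by
  have hsub : ∀ F : Finset V, ∃ n, F ⊆ K n := by
    intro F
    choose f hf using hex
    exact ⟨F.sup f, fun v hv => hK (Finset.le_sup hv) (hf v)⟩
  -- Two vertices joined outside `K n` are also joined outside any smaller finite set `F`.
  have hconn' : ∀ (F : Finset V) n x y, F ⊆ K n → x ∉ (K n : Set V) → y ∉ (K n : Set V) →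
      c x = c y → ∀ (hx : x ∉ (F : Set V)) (hy : y ∉ (F : Set V)),
      G.componentComplMk hx = G.componentComplMk hy := by
    intro F n x y hF hx hy hc hx' hy'
    exact congrArg (fun C => SimpleGraph.ComponentCompl.hom (Finset.coe_subset.mpr hF) C)
      (hconn n x y hx hy hc)
  let idx : ∀ n, G.ComponentCompl (K n) → I := fun n =>
    SimpleGraph.ComponentCompl.lift (fun v _ => c v) fun v w hv hw h => hadj n v w hv hw h
  have hidx_inj : ∀ n, Function.Injective (idx n) := by
    intro n C D
    refine SimpleGraph.ComponentCompl.ind (fun v hv => ?_) C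
    refine SimpleGraph.ComponentCompl.ind (fun w hw => ?_) D
    exact fun h => hconn n v w hv hw h
  have hidx_hom : ∀ {n n'} (h : n ≤ n') (C : G.ComponentCompl (K n')),
      idx n (C.hom (Finset.coe_subset.mpr (hK h))) = idx n' C := by
    intro n n' h C
    exact SimpleGraph.ComponentCompl.ind (fun v hv => rfl) C
  have hsec : ∀ (s : G.end) {F F' : Finset V} (h : F ⊆ F'),
      SimpleGraph.ComponentCompl.hom (Finset.coe_subset.mpr h) (s.1 (.op F')) = s.1 (.op F) :=
    fun s F F' h => s.2 (CategoryTheory.opHomOfLE h)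
  -- The value of `c` attached to an end is the same at every level `K n`, and it picks out one
  -- component there; since the `K n` exhaust `V`, the value at `K 0` determines the end.
  refine Nat.card_congr (Equiv.ofBijective (fun s => idx 0 (s.1 (.op (K 0)))) ⟨?_, ?_⟩)
  · intro s t hst
    have h1 : ∀ n, s.1 (.op (K n)) = t.1 (.op (K n)) := by
      intro n
      apply hidx_inj n
      have hs := hidx_hom (Nat.zero_le n) (s.1 (.op (K n)))
      have ht := hidx_hom (Nat.zero_le n) (t.1 (.op (K n)))
      rw [hsec s (hK (Nat.zero_le n))] at hs
      rw [hsec t (hK (Nat.zero_le n))] at ht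
      exact hs.symm.trans (Eq.trans hst ht)
    refine Subtype.ext (funext fun F => ?_)
    obtain ⟨F⟩ := F
    obtain ⟨n, hn⟩ := hsub F
    rw [← hsec s hn, ← hsec t hn, h1]
  · intro i
    -- For surjectivity, the component outside `F` is that of a vertex with value `i` outside some
    -- `K n` containing `F`; `key` shows that the choice of `n` is immaterial.
    choose N hN using hsub
    choose x hx hxi using fun n => hne n i
    have hxF : ∀ F n, F ⊆ K n → x n ∉ (F : Set V) := fun F n h h' => hx n (h h')
    have key : ∀ (F : Finset V) {n n'} (h : F ⊆ K n) (h' : F ⊆ K n'),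
        G.componentComplMk (hxF F n h) = G.componentComplMk (hxF F n' h') := by
      intro F n n' h h'
      have h'' : F ⊆ K (max n n') := h.trans (hK (le_max_left _ _))
      refine (hconn' F n _ _ h (hx n) (fun hh => hx _ (hK (le_max_left n n') hh))
        ((hxi _).trans (hxi _).symm) _ (hxF F _ h'')).trans
        (hconn' F n' _ _ h' (fun hh => hx _ (hK (le_max_right n n') hh)) (hx n')
        ((hxi _).trans (hxi _).symm) _ _)
    refine ⟨⟨fun F => G.componentComplMk (hxF F.unop _ (hN F.unop)), ?_⟩, ?_⟩
    · intro F F' f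
      exact key F'.unop ((CategoryTheory.le_of_op_hom f).trans (hN F.unop)) (hN F'.unop)
    · exact hxi _

/-! ### The ends of the graphs `tildeGamma ω π`. -/

namespace Spinal

open LabeledGraph

variable {d m : ℕ}

/-- The point `(d-1)^l 0 y (d-1)^ℕ`. -/
def spinePoint (l : ℕ) (y : ZMod d) : Boundary d := fun k =>
  if k < l then -1 else if k = l then 0 else if k = l + 1 then y else -1

/-- Some letter from position `N` on is not `d-1`. -/
def IsOutside (N : ℕ) (η : Boundary d) : Prop := ∃ k, N ≤ k ∧ η k ≠ -1

/-- A path to `η'` from `η` outside the points with tail `(d-1)^ℕ` from position `N` on. -/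
def OutsidePath (ω : ℕ → Epi d m) (N : ℕ) (η η' : Boundary d) : Prop :=
  Relation.ReflTransGen
    (fun x y => (∃ s, bdAct ω s x = y) ∧ IsOutside N x ∧ IsOutside N y) η η'

theorem finite_not_isOutside [NeZero d] (N : ℕ) : {η : Boundary d | ¬IsOutside N η}.Finite := by
  refine (Set.finite_range fun (f : Fin N → ZMod d) k =>
    if h : k < N then f ⟨k, h⟩ else -1).subset ?_
  intro η hη
  refine ⟨fun k => η k, funext fun k => ?_⟩
  by_cases hk : k < N
  · exact dif_pos hk
  · refine (dif_neg hk).trans (by_contra fun h => hη ⟨k, not_lt.mp hk, fun h' => h h'.symm⟩)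

theorem tildeAct_snd {ω : ℕ → Epi d m} {π : B d m →+ ZMod d} (s : Label d m)
    {p : MulAction.orbit (spinalGroup ω) (lastRay d) × ZMod d} (hp : p.1.1 ≠ lastRay d) :
    (tildeAct ω π s p).2 = p.2 := by
  rcases s with j | b
  · rfl
  · exact if_neg hp

theorem IsOutside.ne_lastRay {N : ℕ} {η : Boundary d} (h : IsOutside N η) : η ≠ lastRay d := by
  rintro rfl
  obtain ⟨k, -, hk⟩ := h
  exact hk rfl

variable [Nontrivial (ZMod d)] {ω : ℕ → Epi d m}

theorem isOutside_spinePoint {N l : ℕ} (h : N ≤ l) (y : ZMod d) : IsOutside N (spinePoint l y) :=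
  ⟨l, h, by simp [spinePoint]⟩

/-- The Gray-code path changes only letters before `M`, so a fixed letter beyond both `N` and `M`
keeps it outside. -/
theorem outsidePath_of_eq {N M : ℕ} {η η' : Boundary d} (hM : ∃ k, N ≤ k ∧ M ≤ k ∧ η k ≠ -1)
    (h : ∀ k, M ≤ k → η k = η' k) : OutsidePath ω N η η' := by
  obtain ⟨l, hNl, hMl, hl⟩ := hM
  have key : ∀ ζ, Relation.ReflTransGen
      (fun x y => (∃ s, bdAct ω s x = y) ∧ ∀ k, M ≤ k → x k = y k) η ζ →
      OutsidePath ω N η ζ ∧ ζ l = η l := by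
    intro ζ hζ
    induction hζ with
    | refl => exact ⟨.refl, rfl⟩
    | tail _ hbc ih =>
      have h1 := (hbc.2 l hMl).symm.trans ih.2
      exact ⟨ih.1.tail ⟨hbc.1, ⟨l, hNl, by rwa [ih.2]⟩, ⟨l, hNl, by rwa [h1]⟩⟩, h1⟩
  exact (key _ (reflTransGen_of_eventually_eq ω h)).1

/-- The letter at `l + 1` keeps the path outside while the prefix becomes `(d-1)^l 0`. One element
of `B` then sets that letter to `y`, and the result is outside because of the `0` at `l` or because
of `y` itself. -/
theorem outsidePath_spinePoint {N l : ℕ} (hN : N ≤ l + 1) {η : Boundary d}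
    (hη : η (l + 1) ≠ -1) (hη' : ∀ k, l + 1 < k → η k = -1) {y : ZMod d}
    (hy : N ≤ l ∨ y ≠ -1) : OutsidePath ω N η (spinePoint l y) := by
  have h1 : OutsidePath ω N η (spinePoint l (η (l + 1))) := by
    refine outsidePath_of_eq (M := l + 1) ⟨l + 1, hN, le_rfl, hη⟩ fun k hk => ?_
    simp only [spinePoint, if_neg (show ¬k < l by omega), if_neg (show ¬k = l by omega)]
    split_ifs with h
    · rw [h]
    · exact hη' k (by omega)
  have hout : ∀ y : ZMod d, N ≤ l ∨ y ≠ -1 → IsOutside N (spinePoint l y) := by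
    rintro y (hy | hy)
    · exact isOutside_spinePoint hy y
    · exact ⟨l + 1, hN, by simpa [spinePoint] using hy⟩
  by_cases hne : spinePoint l (η (l + 1)) = spinePoint l y
  · rwa [← hne]
  refine h1.tail ⟨exists_bdAct_eq ω (n := l) ?_ ?_ ?_ hne, hout _ (Or.inr hη), hout _ hy⟩
  · exact fun k hk => if_pos hk
  · simp [spinePoint]
  · intro k hk
    simp only [spinePoint, if_neg hk]

/-- Replacing the last letter different from `d-1` by `d-1` leaves the `0` just before it as the new
last such letter. Descending in this way leads every outside point to the same hub `spinePoint N 0`.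
-/
theorem outsidePath_of_top {N M : ℕ} (hM : N + 1 ≤ M) {η : Boundary d} (hη : η M ≠ -1)
    (hη' : ∀ k, M < k → η k = -1) : OutsidePath ω (N + 1) η (spinePoint N 0) := by
  induction M, hM using Nat.le_induction generalizing η with
  | base => exact outsidePath_spinePoint le_rfl hη hη' (Or.inr neg_one_ne_zero'.symm)
  | succ M hM ih =>
    refine (outsidePath_spinePoint (y := -1) (by omega) hη hη' (Or.inl hM)).trans (ih ?_ ?_)
    · simp [spinePoint]
    · intro k hk
      simp [spinePoint, show ¬k < M by omega, show ¬k = M by omega]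

theorem outsidePath_spinePoint_of_mem_Cof {N : ℕ} {η : Boundary d} (h : IsOutside (N + 1) η)
    (hη : η ∈ Cof (lastRay d)) : OutsidePath ω (N + 1) η (spinePoint N 0) := by
  classical
  obtain ⟨n, hn⟩ := mem_Cof_lastRay.mp hη
  obtain ⟨k, hk, hk'⟩ := h
  let M := Nat.findGreatest (fun k => η k ≠ -1) n
  have hkn : k ≤ n := by
    by_contra hkn
    exact hk' (hn k (by omega))
  refine outsidePath_of_top (M := M) (hk.trans (Nat.le_findGreatest hkn hk'))
    (Nat.findGreatest_spec (P := fun k => η k ≠ -1) hkn hk') fun l hl => ?_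
  by_contra h
  by_cases hln : l ≤ n
  · exact Nat.findGreatest_is_greatest hl hln h
  · exact h (hn l (by omega))

theorem mem_orbit_lastRay_iff {η : Boundary d} :
    η ∈ MulAction.orbit (spinalGroup ω) (lastRay d) ↔ η ∈ Cof (lastRay d) := by
  rw [mem_orbit_iff]
  constructor
  · rintro ⟨w, rfl⟩
    obtain ⟨n, hn⟩ := exists_wordAct_apply_eq ω w (lastRay d)
    exact ⟨n, fun k hk => (hn k hk).symm⟩
  · rintro ⟨n, hn⟩
    exact exists_wordAct_eq ω hn

/-- An outside path avoids `(d-1)^ℕ`, the only place where the copy can change, so it lifts to a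
path within one copy. -/
theorem componentComplMk_eq_of_outsidePath (π : Epi d m) {N : ℕ}
    {K : Set (MulAction.orbit (spinalGroup ω) (lastRay d) × ZMod d)}
    (hK : ∀ p, p ∉ K ↔ IsOutside N p.1.1)
    {p q : MulAction.orbit (spinalGroup ω) (lastRay d) × ZMod d} (hp : p ∉ K) (hq : q ∉ K)
    (hpq : p.2 = q.2) (h : OutsidePath ω N p.1.1 q.1.1) :
    (tildeGamma ω π).toSimpleGraph.componentComplMk hp =
      (tildeGamma ω π).toSimpleGraph.componentComplMk hq := by
  have key : ∀ η, OutsidePath ω N p.1.1 η → ∀ q (hq : q ∉ K), p.2 = q.2 → q.1.1 = η →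
      (tildeGamma ω π).toSimpleGraph.componentComplMk hp =
        (tildeGamma ω π).toSimpleGraph.componentComplMk hq := by
    intro η hη
    induction hη with
    | refl =>
      intro q hq h2 h1
      obtain rfl : q = p := Prod.ext (Subtype.ext h1) h2.symm
      rfl
    | @tail b c hb hbc ih =>
      intro q hq h2 h1
      obtain ⟨⟨s, hs⟩, hbo, -⟩ := hbc
      have hmem : b ∈ MulAction.orbit (spinalGroup ω) (lastRay d) := by
        have : b = bdAct ω (labelInv s) q.1.1 := by rw [h1, ← hs, bdAct_inv]
        rw [this]
        exact (gen ω (labelInv s) • q.1).2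
      rw [ih (⟨b, hmem⟩, q.2) ((hK _).mpr hbo) h2 rfl]
      have hact : q = tildeAct ω π.1 s (⟨b, hmem⟩, q.2) :=
        Prod.ext (Subtype.ext (h1.trans hs.symm)) 
          (tildeAct_snd (p := (⟨b, hmem⟩, q.2)) s hbo.ne_lastRay).symm
      by_cases hne : ((⟨b, hmem⟩, q.2) : MulAction.orbit (spinalGroup ω) (lastRay d) × ZMod d) = q
      · congr
      · refine SimpleGraph.componentComplMk_eq_of_adj _ _ _ (adj_of_edge _ (s := s) ?_ hne)
        exact ((isActionGraph_tildeGamma ω π).edge_iff s _ _).mpr hact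
  exact key _ h q hq hpq rfl

/-- The exhausting sets consist of the vertices whose letters from position `n + 1` on are all
`d-1`. Outside such a set, the vertices of each copy are all joined to one hub and the copies are
mutually disconnected. -/
theorem card_end_tildeGamma [NeZero d] (ω : ℕ → Epi d m) (π : Epi d m) :
    Nat.card (tildeGamma ω π).toSimpleGraph.end = d := by
  have hfin : ∀ n, {p : MulAction.orbit (spinalGroup ω) (lastRay d) × ZMod d |
      ¬IsOutside (n + 1) p.1.1}.Finite := fun n =>
    (((finite_not_isOutside (n + 1)).preimage Subtype.val_injective.injOn).prod
      (Set.finite_univ (α := ZMod d))).subset fun p hp => ⟨hp, trivial⟩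
  have hmem : ∀ n p, p ∉ (hfin n).toFinset ↔ IsOutside (n + 1) p.1.1 := by
    intro n p
    rw [Set.Finite.mem_toFinset, mem_ofPred_eq, not_not]
  rw [SimpleGraph.card_end_eq (tildeGamma ω π).toSimpleGraph (K := fun n => (hfin n).toFinset)
    ?_ ?_ Prod.snd ?_ ?_ ?_, Nat.card_zmod]
  · intro n n' hn p
    contrapose
    rw [hmem, hmem]
    rintro ⟨k, hk, hk'⟩
    exact ⟨k, by omega, hk'⟩
  · intro p
    obtain ⟨n, hn⟩ := mem_Cof_lastRay.mp (mem_orbit_lastRay_iff.mp p.1.2)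
    refine ⟨n, by_contra fun h => ?_⟩
    obtain ⟨k, hk, hk'⟩ := (hmem n p).mp h
    exact hk' (hn k (by omega))
  · intro n x y hx hy hadj
    rw [hmem] at hx hy
    rcases (adj_iff _ _ _).mp hadj with ⟨-, ⟨s, hs⟩ | ⟨s, hs⟩⟩
    · rw [((isActionGraph_tildeGamma ω π).edge_iff s _ _).mp hs, tildeAct_snd s hx.ne_lastRay]
    · rw [((isActionGraph_tildeGamma ω π).edge_iff s _ _).mp hs, tildeAct_snd s hy.ne_lastRay]
  · intro n x y hx hy hxy
    have hK : ∀ p, p ∉ ((hfin n).toFinset :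
        Set (MulAction.orbit (spinalGroup ω) (lastRay d) × ZMod d)) ↔ IsOutside (n + 1) p.1.1 := hmem n
    have hz : IsOutside (n + 1) (spinePoint n (0 : ZMod d)) :=
      ⟨n + 1, le_rfl, by simp [spinePoint]⟩
    have hzo : spinePoint n (0 : ZMod d) ∈ MulAction.orbit (spinalGroup ω) (lastRay d) :=
      mem_orbit_lastRay_iff.mpr (mem_Cof_lastRay.mpr ⟨n + 2, fun k hk => by
        simp [spinePoint, show ¬k < n by omega, show ¬k = n by omega, show ¬k = n + 1 by omega]⟩)
    have key : ∀ p (hp : p ∉ ((hfin n).toFinset :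
        Set (MulAction.orbit (spinalGroup ω) (lastRay d) × ZMod d))), p.2 = y.2 →
        (tildeGamma ω π).toSimpleGraph.componentComplMk hp =
        (tildeGamma ω π).toSimpleGraph.componentComplMk ((hK (⟨_, hzo⟩, y.2)).mpr hz) :=
      fun p hp h2 => componentComplMk_eq_of_outsidePath π hK hp _ h2
        (outsidePath_spinePoint_of_mem_Cof ((hK p).mp hp) (mem_orbit_lastRay_iff.mp p.1.2))
    exact (key x hx hxy).trans (key y hy rfl).symm
  · intro n i
    have hzo : spinePoint (n + 1) (-1 : ZMod d) ∈ MulAction.orbit (spinalGroup ω) (lastRay d) :=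
      mem_orbit_lastRay_iff.mpr (mem_Cof_lastRay.mpr ⟨n + 2, fun k hk => by
        simp [spinePoint, show ¬k < n + 1 by omega, show ¬k = n + 1 by omega]⟩)
    exact ⟨(⟨_, hzo⟩, i), (hmem n _).mpr (isOutside_spinePoint le_rfl _), rfl⟩

end Spinal

namespace Spinal

open LabeledGraph

variable {d m : ℕ}

/-! ### Local convergence of Schreier graphs -/

theorem eventually_agree (ξ : Boundary d) (N : ℕ) : ∀ᶠ ξ' in 𝓝 ξ, ∀ k < N, ξ' k = ξ k := by
  refine (Filter.eventually_all_finite (Set.finite_lt_nat N)).mpr fun k _ => ?_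
  have h : {ξ k} ∈ 𝓝 (ξ k) := (isOpen_discrete _).mem_nhds rfl
  exact (continuous_apply k).continuousAt h

theorem tendsto_update (ξ : Boundary d) (x : ZMod d) :
    Filter.Tendsto (fun N => Function.update ξ N x) Filter.atTop (𝓝 ξ) := by
  refine tendsto_pi_nhds.mpr fun k => tendsto_const_nhds.congr' ?_
  filter_upwards [Filter.eventually_gt_atTop k] with N hN
  rw [Function.update_of_ne hN.ne]

theorem wordAct_gen_eq_iff' (ω : ℕ → Epi d m) {ξ : Boundary d} (w : List (Label d m))
    (u : MulAction.orbit (spinalGroup ω) ξ) :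
    wordAct (fun s u => gen ω s • u) w u = u ↔ wordAct (bdAct ω) w u.1 = u.1 := by
  rw [Subtype.ext_iff, coe_wordAct_gen]

theorem ballIso_rootedSchreier [NeZero d] {ω : ℕ → Epi d m} {ξ ξ' : Boundary d} {r : ℕ}
    (i : ZMod d) (h : ∀ w : List (Label d m), w.length ≤ 2 * r + 1 →
      (wordAct (extAct ω 0) w (ξ, i) = (ξ, i) ↔ wordAct (bdAct ω) w ξ' = ξ')) :
    (rootedSchreier ω ξ).graph.BallIso r (rootedSchreier ω ξ).root
      (rootedSchreier ω ξ').graph (rootedSchreier ω ξ').root := by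
  refine (isActionGraph_schreierGraph ω ξ).ballIso (isActionGraph_schreierGraph ω ξ') r
    fun w hw => ?_
  exact (wordAct_gen_eq_iff ω w _ i).trans ((h w hw).trans (wordAct_gen_eq_iff' ω w
    ⟨ξ', MulAction.mem_orbit_self ξ'⟩).symm)

/-- Close to `ξ`, the first disagreement occurs where `ξ` already has the letter `d-1`, so `ξ'` has
another letter there. The pair `a` ranges over a finite set, so that an ultrafilter can later fix
it. -/
theorem eventually_trichotomy (ω : ℕ → Epi d m) {ξ : Boundary d} (h : ξ ∈ Cof (lastRay d)) :
    ∀ᶠ ξ' in 𝓝 ξ, ξ' = ξ ∨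
      (∃ N, (∀ k < N, ξ' k = ξ k) ∧ ξ' N ≠ ξ N ∧ ξ' N ≠ 0 ∧ ξ' N ≠ -1) ∨
      ∃ a : Epi d m × ZMod d, ∃ N, ω N = a.1 ∧ (∀ k < N, ξ' k = ξ k) ∧ ξ' N ≠ ξ N ∧
        ξ' N = 0 ∧ ξ' (N + 1) = a.2 := by
  classical
  obtain ⟨n, hn⟩ := mem_Cof_lastRay.mp h
  filter_upwards [eventually_agree ξ n] with ξ' hξ'
  by_cases heq : ξ' = ξ
  · exact Or.inl heq
  right
  have hex := Function.ne_iff.mp heq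
  have hN := Nat.find_spec hex
  have hlt : ∀ k < Nat.find hex, ξ' k = ξ k := fun k hk => not_not.mp (Nat.find_min hex hk)
  have hnN : n ≤ Nat.find hex := not_lt.mp fun hlt => hN (hξ' _ hlt)
  by_cases h0 : ξ' (Nat.find hex) = 0
  · exact Or.inr ⟨(ω (Nat.find hex), _), Nat.find hex, rfl, hlt, hN, h0, rfl⟩
  · exact Or.inl ⟨Nat.find hex, hlt, hN, h0, fun h1 => hN (h1.trans (hn _ hnN).symm)⟩

theorem isolatedPoints_subset_range (f : Boundary d → RootedGraphSpace (Label d m)) :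
    isolatedPoints (closure (Set.range f)) ⊆ Set.range f := by
  rintro x ⟨U, hU, hUC⟩
  have hx := hUC.ge rfl
  obtain ⟨y, hyU, hy⟩ := mem_closure_iff.mp hx.2 U hU hx.1
  have h3 : y ∈ U ∩ closure (Set.range f) := ⟨hyU, subset_closure hy⟩
  rw [hUC] at h3
  rwa [← show y = x from h3]

variable [NeZero d]

instance finite_Epi : Finite (Epi d m) := by
  have : Finite (B d m →+ ZMod d) := Finite.of_injective _ DFunLike.coe_injective
  exact Subtype.finite

theorem recurrentEpi_nonempty (ω : ℕ → Epi d m) : (recurrentEpi ω).Nonempty := by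
  obtain ⟨π, hπ⟩ := Finite.exists_infinite_fiber ω
  exact ⟨π, Set.infinite_coe_iff.mp hπ⟩

theorem eq_Sch_of_tendsto {ω : ℕ → Epi d m} {l : Filter (Boundary d)} [l.NeBot] {ξ : Boundary d}
    {x : RootedGraphSpace (Label d m)} (h : Filter.Tendsto (Sch ω) l (𝓝 (Sch ω ξ)))
    (hx : Filter.Tendsto (Sch ω) l (𝓝 x)) : x = Sch ω ξ :=
  RootedGraph.eq_of_tendsto (Γ := rootedSchreier ω ξ) (isActionGraph_schreierGraph ω ξ) h hx

theorem countable_limitGraphs (ω : ℕ → Epi d m) : (limitGraphs ω).Countable := by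
  have hc : Countable (MulAction.orbit (spinalGroup ω) (lastRay d)) := by
    refine Set.Countable.to_subtype
      ((Set.countable_range fun w : List (Label d m) => wordAct (bdAct ω) w (lastRay d)).mono ?_)
    intro η hη
    exact (mem_orbit_iff ω).mp hη
  refine (Set.countable_range fun a : Epi d m × MulAction.orbit (spinalGroup ω) (lastRay d) × ZMod d
    => (rootedTildeGamma ω a.1 a.2).toSpace).mono ?_
  rintro _ ⟨π, -, p, rfl⟩
  exact ⟨(π, p), rfl⟩

variable [Nontrivial (ZMod d)] {ω : ℕ → Epi d m}

/-- After the prefix `(d-1)^N`, a letter other than `0` and `d-1` makes `B` act trivially, so a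
constant family of tails is compatible with `π = 0`. -/
theorem eventually_ballIso (ω : ℕ → Epi d m) (ξ : Boundary d) (r : ℕ) :
    ∀ᶠ N in Filter.atTop, ∀ ξ' : Boundary d, (∀ k < N, ξ' k = ξ k) →
      (ξ ∉ Cof (lastRay d) ∨ (ξ' N ≠ 0 ∧ ξ' N ≠ -1)) →
      (rootedSchreier ω ξ).graph.BallIso r (rootedSchreier ω ξ).root
        (rootedSchreier ω ξ').graph (rootedSchreier ω ξ').root := by
  filter_upwards [eventually_wordAct_glue_eq_iff ω 0 (ξ, 0) (2 * r + 1)] with N hN ξ' hξ' h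
  refine ballIso_rootedSchreier 0 fun w hw => ?_
  rw [hN (fun _ k => ξ' (k + N)) (h.imp_right fun h b i => ?_) (Or.inl rfl) w hw]
  · simp only [glue_drop hξ']
  · refine spine_eq_self ω b fun n hn => ?_
    have hval : glue N (lastRay d) (fun k => ξ' (k + N)) N = ξ' N := by
      rw [glue_of_le le_rfl, Nat.sub_self, Nat.zero_add]
    rcases lt_trichotomy n N with hlt | rfl | hlt
    · have := hn.2
      rw [glue_of_lt hlt] at this
      exact neg_one_ne_zero' this
    · exact h.1 (hval ▸ hn.2)
    · exact h.2 (hval ▸ hn.1 N hlt)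

theorem eventually_ballIso_tildeGamma (ω : ℕ → Epi d m) (π : Epi d m)
    (p : MulAction.orbit (spinalGroup ω) (lastRay d) × ZMod d) (r : ℕ) :
    ∀ᶠ N in Filter.atTop, ∀ ξ' : Boundary d, ω N = π → (∀ k < N, ξ' k = p.1.1 k) →
      ξ' N = 0 → ξ' (N + 1) = p.2 →
      (rootedTildeGamma ω π p).graph.BallIso r (rootedTildeGamma ω π p).root
        (rootedSchreier ω ξ').graph (rootedSchreier ω ξ').root := by
  filter_upwards [eventually_wordAct_glue_eq_iff ω π.1 (p.1.1, p.2) (2 * r + 1)]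
    with N hN ξ' hω hξ' h0 h1
  refine (isActionGraph_tildeGamma ω π).ballIso (isActionGraph_schreierGraph ω ξ') r
    fun w hw => ?_
  refine (wordAct_tildeAct_eq_iff ω π.1 w p).trans (Iff.trans ?_ (wordAct_gen_eq_iff' ω w _).symm)
  -- After `(d-1)^N 0`, the next letter encodes the copy: `B` acts on it through `ω N = π`.
  let τ : ZMod d → Boundary d := fun i => cons 0 (cons i fun k => ξ' (k + 2 + N))
  have hτ : τ p.2 = fun k => ξ' (k + N) := by
    funext k
    rcases k with _ | _ | k
    · simp [τ, h0]
    · simp [τ, ← h1, add_comm]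
    · rfl
  rw [hN τ (Or.inr fun b i => ?_) (Or.inr fun i j hij => congrFun hij 1) w hw]
  · simp only [hτ, glue_drop hξ']
    rfl
  · rw [spine_of_prefix ω b (n := N) (fun k hk => glue_of_lt hk _ _) (by
      rw [glue_of_le le_rfl, Nat.sub_self]; rfl), hω]
    funext k
    rcases lt_trichotomy k (N + 1) with hk | rfl | hk
    · rw [Function.update_of_ne hk.ne]
      by_cases hkN : k < N
      · rw [glue_of_lt hkN, glue_of_lt hkN]
      · obtain rfl : k = N := by omega
        rw [glue_of_le le_rfl, glue_of_le le_rfl, Nat.sub_self]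
        rfl
    · rw [Function.update_self, glue_of_le (Nat.le_succ N), glue_of_le (Nat.le_succ N),
        show N.succ - N = 1 by omega]
      rfl
    · rw [Function.update_of_ne hk.ne', glue_of_le (by omega), glue_of_le (by omega)]
      obtain ⟨l, rfl⟩ : ∃ l, k = l + 2 + N := ⟨k - N - 2, by omega⟩
      rw [Nat.add_sub_cancel]
      rfl

theorem continuousAt_Sch {ξ : Boundary d} (h : ξ ∉ Cof (lastRay d)) :
    ContinuousAt (Sch ω) ξ := by
  refine RootedGraph.tendsto_toSpace_iff.mpr fun r => ?_
  obtain ⟨N, hN⟩ := (eventually_ballIso ω ξ r).exists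
  filter_upwards [eventually_agree ξ N] with ξ' hξ' using hN ξ' hξ' (Or.inl h)

theorem tendsto_Sch_tildeGamma {π : Epi d m}
    {p : MulAction.orbit (spinalGroup ω) (lastRay d) × ZMod d} {l : Filter (Boundary d)}
    (hl : l ≤ 𝓝 p.1.1) (h : ∀ᶠ ξ' in l, ∃ N, ω N = π ∧ (∀ k < N, ξ' k = p.1.1 k) ∧ ξ' N ≠ p.1.1 N ∧
      ξ' N = 0 ∧ ξ' (N + 1) = p.2) :
    Filter.Tendsto (Sch ω) l (𝓝 (rootedTildeGamma ω π p).toSpace) := by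
  refine RootedGraph.tendsto_toSpace_iff.mpr fun r => ?_
  obtain ⟨M, hM⟩ := Filter.eventually_atTop.mp (eventually_ballIso_tildeGamma ω π p r)
  filter_upwards [h, hl (eventually_agree p.1.1 M)] with ξ' ⟨N, h1, h2, h3, h4, h5⟩ hξ'
  -- Agreement on the first `M` letters pushes the disagreement at `N` to `N ≥ M`.
  exact hM N (not_lt.mp fun h => h3 (hξ' N h)) ξ' h1 h2 h4 h5

theorem tendsto_Sch_of_ne {ξ : Boundary d} {l : Filter (Boundary d)} (hl : l ≤ 𝓝 ξ)
    (h : ∀ᶠ ξ' in l, ∃ N, (∀ k < N, ξ' k = ξ k) ∧ ξ' N ≠ ξ N ∧ ξ' N ≠ 0 ∧ ξ' N ≠ -1) :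
    Filter.Tendsto (Sch ω) l (𝓝 (Sch ω ξ)) := by
  refine RootedGraph.tendsto_toSpace_iff.mpr fun r => ?_
  obtain ⟨M, hM⟩ := Filter.eventually_atTop.mp (eventually_ballIso ω ξ r)
  filter_upwards [h, hl (eventually_agree ξ M)] with ξ' ⟨N, h1, h2, h3⟩ hξ'
  exact hM N (not_lt.mp fun h => h2 (hξ' N h)) ξ' h1 (Or.inr h3)

/-! ### Injectivity and disjointness -/

theorem Sch_injective (hdm : (d = 2 ∧ 2 ≤ m) ∨ (3 ≤ d ∧ 1 ≤ m)) (hω : ω ∈ Omega d m) :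
    Function.Injective (Sch ω) := by
  intro ξ η h
  have h1 := RootedGraph.toSpace_eq_iff.mp h
  have h2 : SameStab ω 0 0 (ξ, 0) (η, 0) := fun w => by
    have := (h1.ballIso w.length).wordAct_eq_iff (isActionGraph_schreierGraph ω ξ)
      (isActionGraph_schreierGraph ω η) le_rfl
    exact (wordAct_gen_eq_iff ω w _ 0).symm.trans (this.trans (wordAct_gen_eq_iff ω w _ 0))
  exact funext (h2.apply_eq hdm hω)

/-- Equal stabilisers would give equal boundary points. After both are moved to `(d-1)^ℕ`, an
element `b` with `π b = 1` fixes the vertex of the Schreier graph but changes the copy in the other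
graph. -/
theorem Sch_ne_toSpace (hdm : (d = 2 ∧ 2 ≤ m) ∨ (3 ≤ d ∧ 1 ≤ m)) (hω : ω ∈ Omega d m)
    (ξ : Boundary d) (π : Epi d m) (p : MulAction.orbit (spinalGroup ω) (lastRay d) × ZMod d) :
    Sch ω ξ ≠ (rootedTildeGamma ω π p).toSpace := by
  intro h
  have h1 := RootedGraph.toSpace_eq_iff.mp h
  have h2 : SameStab ω 0 π.1 (ξ, 0) (p.1.1, p.2) := fun w => by
    have := (h1.ballIso w.length).wordAct_eq_iff (isActionGraph_schreierGraph ω ξ)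
      (isActionGraph_tildeGamma ω π) le_rfl
    exact (wordAct_gen_eq_iff ω w _ 0).symm.trans (this.trans (wordAct_tildeAct_eq_iff ω π.1 w p))
  have h3 : ξ = p.1.1 := funext (h2.apply_eq hdm hω)
  obtain ⟨n, hn⟩ := mem_orbit_lastRay_iff.mp p.1.2
  obtain ⟨w, hw⟩ := exists_wordAct_eq ω fun k hk => (hn k hk).symm
  obtain ⟨b, hb⟩ := exists_label_eq π (one_ne_zero (α := ZMod d))
  have h4 := h2.wordAct w [Sum.inr b]
  simp only [LabeledGraph.wordAct_cons, LabeledGraph.wordAct_nil] at h4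
  rw [extAct_inr_lastRay ω 0 b (by rw [wordAct_extAct_fst, h3, hw]),
    extAct_inr_lastRay ω π.1 b (by rw [wordAct_extAct_fst, hw]), hb] at h4
  have h5 := congrArg Prod.snd (h4.mp (Prod.ext rfl (add_zero _)))
  exact one_ne_zero (add_eq_left.mp h5)

/-! ### The closure -/

/-- The graph `(tildeGamma ω π, p)` is a limit of Schreier graphs of points tending to the
boundary point of `p`. -/
theorem exists_tendsto_Sch_tildeGamma {π : Epi d m} (hπ : π ∈ recurrentEpi ω)
    (p : MulAction.orbit (spinalGroup ω) (lastRay d) × ZMod d) :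
    ∃ l : Filter (Boundary d), l.NeBot ∧ l ≤ 𝓝 p.1.1 ∧
      Filter.Tendsto (Sch ω) l (𝓝 (rootedTildeGamma ω π p).toSpace) := by
  -- The points keep the first `N` letters of `p`, followed by `0` and by the copy `p.2`; only the
  -- infinitely many `N` with `ω N = π` are used.
  let f : ℕ → Boundary d := fun N => glue N p.1.1 (cons 0 (cons p.2 0))
  have hf : Filter.Tendsto f Filter.atTop (𝓝 p.1.1) := by
    refine tendsto_pi_nhds.mpr fun k => tendsto_const_nhds.congr' ?_
    filter_upwards [Filter.eventually_gt_atTop k] with N hN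
    exact (glue_of_lt hN _ _).symm
  obtain ⟨n, hn⟩ := mem_orbit_lastRay_iff.mp p.1.2
  let l := Filter.map f (Filter.atTop ⊓ Filter.principal {N | ω N = π})
  have : (Filter.atTop ⊓ Filter.principal {N | ω N = π}).NeBot := by
    rw [← Nat.cofinite_eq_atTop]
    exact Filter.cofinite_inf_principal_neBot_iff.mpr hπ
  have hl : l ≤ 𝓝 p.1.1 := (Filter.map_mono inf_le_left).trans hf
  refine ⟨l, inferInstance, hl, tendsto_Sch_tildeGamma hl ?_⟩
  rw [Filter.eventually_map, Filter.eventually_inf_principal]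
  filter_upwards [Filter.eventually_ge_atTop n] with N hN hNπ
  have h0 : f N N = 0 := by
    simp [f, glue_of_le le_rfl]
  refine ⟨N, hNπ, fun k hk => glue_of_lt hk _ _, ?_, h0, ?_⟩
  · rw [h0, ← hn N hN]
    exact neg_one_ne_zero'.symm
  · simp [f, glue_of_le (Nat.le_succ N)]

/-- Along a suitable filter tending to `ξ` the graphs tend to a limit graph, which by uniqueness of
limits would have to be `Sch ω ξ`. -/
theorem not_continuousAt_Sch (hdm : (d = 2 ∧ 2 ≤ m) ∨ (3 ≤ d ∧ 1 ≤ m)) (hω : ω ∈ Omega d m)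
    {ξ : Boundary d} (h : ξ ∈ Cof (lastRay d)) : ¬ContinuousAt (Sch ω) ξ := by
  intro hc
  obtain ⟨π, hπ⟩ := recurrentEpi_nonempty ω
  obtain ⟨l, _, hl, hlim⟩ := exists_tendsto_Sch_tildeGamma hπ
    (⟨ξ, mem_orbit_lastRay_iff.mpr h⟩, 0)
  exact Sch_ne_toSpace hdm hω ξ π _ (eq_Sch_of_tendsto (hc.mono_left hl) hlim).symm

theorem closure_range_Sch (ω : ℕ → Epi d m) :
    closure (Set.range (Sch ω)) = Set.range (Sch ω) ∪ limitGraphs ω := by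
  refine Subset.antisymm ?_ (union_subset subset_closure ?_)
  · intro x hx
    have hne : (Filter.comap (Sch ω) (𝓝 x)).NeBot := by
      rw [Filter.comap_neBot_iff_frequently]
      exact (mem_closure_iff_frequently.mp hx).mono fun _ h => h
    -- By compactness this ultrafilter of boundary points converges to some `ξ`, and it selects a
    -- single case of the trichotomy.
    let u := Ultrafilter.of (Filter.comap (Sch ω) (𝓝 x))
    have hux : Filter.Tendsto (Sch ω) u (𝓝 x) :=
      Filter.tendsto_iff_comap.mpr (Ultrafilter.of_le _)
    obtain ⟨ξ, -, hξ⟩ := isCompact_univ.ultrafilter_le_nhds u (by simp)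
    by_cases h : ξ ∈ Cof (lastRay d)
    · have htri := hξ (eventually_trichotomy ω h)
      rcases Ultrafilter.eventually_or.mp htri with h1 | h1
      · refine Or.inl ⟨ξ, (eq_Sch_of_tendsto ?_ hux).symm⟩
        exact tendsto_nhds_of_eventually_eq (h1.mono fun _ h => congrArg _ h)
      rcases Ultrafilter.eventually_or.mp h1 with h1 | h1
      · exact Or.inl ⟨ξ, (eq_Sch_of_tendsto (tendsto_Sch_of_ne hξ h1) hux).symm⟩
      · obtain ⟨a, ha⟩ := Ultrafilter.eventually_exists_iff.mp h1
        let p : MulAction.orbit (spinalGroup ω) (lastRay d) × ZMod d :=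
          (⟨ξ, mem_orbit_lastRay_iff.mpr h⟩, a.2)
        refine Or.inr ⟨a.1, ?_, p, RootedGraph.eq_of_tendsto (isActionGraph_tildeGamma ω a.1)
          (tendsto_Sch_tildeGamma (p := p) hξ ha) hux⟩
        -- Points of `u` agree with `ξ` on arbitrarily long prefixes, so the positions `N` with `ω N
        -- = a.1` are unbounded.
        refine Set.infinite_of_forall_exists_gt fun M => ?_
        obtain ⟨ξ', ⟨N, h1, -, h2, -⟩, h3⟩ := (ha.and (hξ (eventually_agree ξ (M + 1)))).exists
        exact ⟨N, h1, not_le.mp fun hN => h2 (h3 N (by omega))⟩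
    · exact Or.inl ⟨ξ, (eq_Sch_of_tendsto ((continuousAt_Sch h).mono_left hξ) hux).symm⟩
  · rintro _ ⟨π, hπ, p, rfl⟩
    obtain ⟨l, _, -, hlim⟩ := exists_tendsto_Sch_tildeGamma hπ p
    exact mem_closure_of_tendsto hlim (Filter.Eventually.of_forall fun ξ => ⟨ξ, rfl⟩)

/-! ### Isolated points -/

/-- Changing one far letter gives distinct points whose graphs converge to that of `ξ`, and
injectivity keeps these graphs different. In the cofinal case the new letter is `1`, which for `d >
2` is neither `0` nor `d-1`. -/
theorem notMem_isolatedPoints (hdm : (d = 2 ∧ 2 ≤ m) ∨ (3 ≤ d ∧ 1 ≤ m)) (hω : ω ∈ Omega d m)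
    {ξ : Boundary d} (h : ξ ∉ Cof (lastRay d) ∨ 2 < d) :
    Sch ω ξ ∉ isolatedPoints (closure (Set.range (Sch ω))) := by
  rintro ⟨U, hU, hUC⟩
  have hmem : U ∈ 𝓝 (Sch ω ξ) := hU.mem_nhds (hUC.ge rfl).1
  have hex : ∃ (l : Filter (Boundary d)) (_ : l.NeBot), Filter.Tendsto (Sch ω) l (𝓝 (Sch ω ξ)) ∧
      ∀ᶠ ξ' in l, ξ' ≠ ξ := by
    rcases Classical.em (ξ ∈ Cof (lastRay d)) with hξ | hξ
    · have hd := h.resolve_left (not_not.mpr hξ)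
      have h1 : (1 : ZMod d) ≠ -1 := fun h1 => hd.ne' (eq_two_of_one_eq_neg_one h1)
      obtain ⟨n, hn⟩ := mem_Cof_lastRay.mp hξ
      refine ⟨Filter.map (fun N => Function.update ξ N 1) Filter.atTop, inferInstance,
        tendsto_Sch_of_ne (tendsto_update ξ 1) ?_, ?_⟩
      · rw [Filter.eventually_map]
        filter_upwards [Filter.eventually_ge_atTop n] with N hN
        refine ⟨N, fun k hk => Function.update_of_ne hk.ne _ _, ?_, ?_, ?_⟩
        · rwa [Function.update_self, hn N hN]
        · rw [Function.update_self]; exact one_ne_zero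
        · rwa [Function.update_self]
      · rw [Filter.eventually_map]
        filter_upwards [Filter.eventually_ge_atTop n] with N hN h2
        have := congrFun h2 N
        rw [Function.update_self, hn N hN] at this
        exact h1 this
    · refine ⟨Filter.map (fun N => Function.update ξ N (ξ N + 1)) Filter.atTop, inferInstance,
        (continuousAt_Sch hξ).mono_left ?_, ?_⟩
      · refine tendsto_pi_nhds.mpr fun k => tendsto_const_nhds.congr' ?_
        filter_upwards [Filter.eventually_gt_atTop k] with N hN
        rw [Function.update_of_ne hN.ne]
      · rw [Filter.eventually_map]
        refine Filter.Eventually.of_forall fun N h2 => ?_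
        have := congrFun h2 N
        rw [Function.update_self] at this
        exact one_ne_zero (add_eq_left.mp this)
  obtain ⟨l, _, hl, hne⟩ := hex
  obtain ⟨ξ', h1, h2⟩ := ((hl.eventually_mem hmem).and hne).exists
  have h3 : Sch ω ξ' ∈ U ∩ closure (Set.range (Sch ω)) := ⟨h1, subset_closure ⟨ξ', rfl⟩⟩
  rw [hUC] at h3
  exact h2 (Sch_injective hdm hω h3)

/-- With two letters, the first letter different from `d-1` must be `0`, so `(d-1)^ℕ` is the only
point fixed by all of `B`. -/
theorem exists_spine_ne (hω : ω ∈ Omega d m) (hd : d = 2) {ξ : Boundary d} (h : ξ ≠ lastRay d) :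
    ∃ b : {b : B d m // b ≠ 0}, spine ω b.1 ξ ≠ ξ := by
  classical
  have hex := Function.ne_iff.mp h
  have hlt : ∀ k < Nat.find hex, ξ k = -1 := fun k hk => not_not.mp (Nat.find_min hex hk)
  have h0 : ξ (Nat.find hex) = 0 := by
    have := Nat.find_spec hex
    change _ ≠ -1 at this
    subst hd
    generalize ξ (Nat.find hex) = a at this
    revert a
    decide
  obtain ⟨b, hb⟩ := exists_label_eq (ω (Nat.find hex)) (one_ne_zero (α := ZMod d))
  refine ⟨b, fun hh => ?_⟩
  have := congrFun hh (Nat.find hex + 1)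
  rw [spine_apply_succ ω b.1 hlt h0, hb] at this
  exact one_ne_zero (add_eq_left.mp this)

/-- If `w` takes `ξ` to `(d-1)^ℕ`, the conjugates of `B` by `w` fix `ξ`, and no other point is fixed
by all of them. They are words of length `2 * w.length + 1`, hence visible in a ball of that radius.
-/
theorem Sch_mem_isolatedPoints (hω : ω ∈ Omega d m) (hd : d = 2) {ξ : Boundary d}
    (h : ξ ∈ Cof (lastRay d)) : Sch ω ξ ∈ isolatedPoints (closure (Set.range (Sch ω))) := by
  obtain ⟨n, hn⟩ := h
  obtain ⟨w, hw⟩ := exists_wordAct_eq ω fun k hk => (hn k hk).symm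
  let U := (rootedSchreier ω ξ).cylinder (2 * w.length + 1)
  have hU : IsOpen U := RootedGraph.isOpen_cylinder _ _
  have hmem : Sch ω ξ ∈ U := RootedGraph.toSpace_mem_cylinder.mpr (.refl _ _ _)
  have hUr : U ∩ Set.range (Sch ω) ⊆ {Sch ω ξ} := by
    rintro _ ⟨hξ', ξ', rfl⟩
    have hiso := RootedGraph.toSpace_mem_cylinder.mp hξ'
    have hfix : ∀ v : List (Label d m), v.length ≤ 2 * w.length + 1 →
        wordAct (bdAct ω) v ξ = ξ → wordAct (bdAct ω) v ξ' = ξ' := by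
      intro v hv h1
      have h2 := hiso.wordAct_eq_iff (isActionGraph_schreierGraph ω ξ)
        (isActionGraph_schreierGraph ω ξ') hv
      have h3 := h2.mp (Subtype.ext ((coe_wordAct_gen ω v _).trans h1))
      exact (coe_wordAct_gen ω v _).symm.trans (congrArg Subtype.val h3)
    have hlast : wordAct (bdAct ω) w ξ' = lastRay d := by
      by_contra hne
      obtain ⟨b, hb⟩ := exists_spine_ne hω hd hne
      have h1 := hfix (invWord labelInv w ++ (Sum.inr b :: w)) (by simp; omega) (by
        rw [wordAct_append, wordAct_cons, hw,
          show bdAct ω (Sum.inr b) (lastRay d) = lastRay d from spine_lastRay ω b.1, ← hw,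
          wordAct_invWord (bdAct_inv ω)])
      rw [wordAct_append, wordAct_cons] at h1
      refine hb (wordAct_injective (bdAct_inv ω) (invWord labelInv w) (h1.trans ?_))
      rw [wordAct_invWord (bdAct_inv ω)]
    exact congrArg _ (wordAct_injective (bdAct_inv ω) w (hlast.trans hw.symm))
  refine ⟨U, hU, Subset.antisymm (fun x hx => ?_) ?_⟩
  · obtain ⟨hxU, hxC⟩ := hx
    -- As `U` is open, its points in the closure are limits of points of `U` in the range, of which
    -- `Sch ω ξ` is the only one; uniqueness of limits then identifies `x`.
    have hx' : x ∈ closure {Sch ω ξ} :=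
      closure_mono hUr (hU.inter_closure ⟨hxU, hxC⟩)
    refine RootedGraph.eq_of_tendsto (Γ := rootedSchreier ω ξ) (l := pure (Sch ω ξ)) (f := id)
      (isActionGraph_schreierGraph ω ξ) (tendsto_pure_nhds _ _) ?_
    exact (pure_le_nhds _).trans (specializes_iff_mem_closure.mpr hx')
  · rintro _ rfl
    exact ⟨hmem, subset_closure ⟨ξ, rfl⟩⟩

end Spinal

/-! ### Assembly of the three statements. -/

theorem mainTheorem2 (d m : ℕ) [NeZero d] (hdm : (d = 2 ∧ 2 ≤ m) ∨ (3 ≤ d ∧ 1 ≤ m))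
    (ω : ℕ → Spinal.Epi d m) (hω : ω ∈ Spinal.Omega d m) :
    (Function.Injective (Spinal.Sch ω) ∧
      ∀ ξ : Spinal.Boundary d,
        ContinuousAt (Spinal.Sch ω) ξ ↔ ξ ∉ Spinal.Cof (Spinal.lastRay d)) ∧
    ((2 < d → isolatedPoints (closure (Set.range (Spinal.Sch ω))) = ∅) ∧
      (d = 2 → isolatedPoints (closure (Set.range (Spinal.Sch ω))) =
        Spinal.Sch ω '' Spinal.Cof (Spinal.lastRay d))) ∧
    (closure (Set.range (Spinal.Sch ω)) =
        Set.range (Spinal.Sch ω) ∪ Spinal.limitGraphs ω ∧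
      Disjoint (Set.range (Spinal.Sch ω)) (Spinal.limitGraphs ω) ∧
      (Spinal.limitGraphs ω).Countable ∧
      (Spinal.recurrentEpi ω).Finite ∧
      ∀ π ∈ Spinal.recurrentEpi ω,
        Nat.card (Spinal.tildeGamma ω π).toSimpleGraph.end = d) := by
  have : Nontrivial (ZMod d) := ZMod.nontrivial_iff.mpr (by omega)
  refine ⟨⟨Spinal.Sch_injective hdm hω, fun ξ => ⟨fun hc h => ?_, Spinal.continuousAt_Sch⟩⟩,
    ⟨fun hd => ?_, fun hd => ?_⟩, Spinal.closure_range_Sch ω, ?_, Spinal.countable_limitGraphs ω,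
    Set.toFinite _, fun π _ => Spinal.card_end_tildeGamma ω π⟩
  · exact Spinal.not_continuousAt_Sch hdm hω h hc
  · refine Set.eq_empty_of_forall_notMem fun x hx => ?_
    obtain ⟨ξ, rfl⟩ := Spinal.isolatedPoints_subset_range _ hx
    exact Spinal.notMem_isolatedPoints hdm hω (Or.inr hd) hx
  · refine Set.Subset.antisymm (fun x hx => ?_) ?_
    · obtain ⟨ξ, rfl⟩ := Spinal.isolatedPoints_subset_range _ hx
      exact ⟨ξ, by_contra fun h => Spinal.notMem_isolatedPoints hdm hω (Or.inl h) hx, rfl⟩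
    · rintro _ ⟨ξ, h, rfl⟩
      exact Spinal.Sch_mem_isolatedPoints hω hd h
  · rw [Set.disjoint_left]
    rintro _ ⟨ξ, rfl⟩ ⟨π, -, p, h⟩
    exact Spinal.Sch_ne_toSpace hdm hω ξ π p h
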